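/- **Definitions.** Let $m\in\frac12\mathbb Z_{>0}$ and $s\in\frac12\mathbb Z$. For $\tau$ in the upper half-plane put $q^r=e^{2\pi i\tau r}$, and for a choice of sign $\pm$ and $z_1,z_2,z\in\mathbb C$, $j\in\frac12\mathbb Z$, define $$\Phi^{\pm[m;s]}(\tau,z_1,z_2)=\sum_{n\in\mathbb Z}(\pm1)^n\frac{e^{2\pi i mn(z_1+z_2)+2\pi i s z_1}q^{mn^2+sn}}{1-e^{2\pi i z_1}q^n},\qquad \Theta^{\pm}_{j,m}(\tau,z)=\sum_{n\in\mathbb Z}(\pm1)^n e^{2\pi i mz(n+\frac j{2m})}q^{m(n+\frac j{2m})^2},$$ $$R^{\pm}_{j,m}(\tau,z)=\sum_{n\in j+2m\mathbb Z}(\pm1)^{\frac{n-j}{2m}}\Bigl\{\operatorname{sign}\bigl(n-\tfrac12-j+2m\bigr)-E\Bigl(\bigl(n-2m\tfrac{\operatorname{Im}z}{\operatorname{Im}\tau}\bigr)\sqrt{\tfrac{\operatorname{Im}\tau}m}\Bigr)\Bigr\}e^{-\frac{\pi i n^2}{2m}\tau+2\pi i nz},\qquad E(x)=2\int_0^x e^{-\pi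 u^2}\,du,$$ $$\widetilde\Phi^{\pm[m;s]}(\tau,z_1,z_2)=\Phi^{\pm[m;s]}(\tau,z_1,z_2)-\frac12\sum_{\substack{j\in s+\mathbb Z\\ s\le j<s+2m}}R^{\pm}_{j,m}\Bigl(\tau,\frac{z_1-z_2}2\Bigr)\,\Theta^{\pm}_{j,m}(\tau,z_1+z_2).$$ The functions $\widetilde\Phi^{\pm[m;s]}$ are regarded as functions on the set of $(\tau,z_1,z_2)$ with $\operatorname{Im}\tau>0$, $z_1\notin\mathbb Z+\tau\mathbb Z$. The group $SL_2(\mathbb Z)$ acts from the right on functions on this set by $$\Bigl(F\big|_{\left(\begin{smallmatrix}a&b\\c&d\end{smallmatrix}\right)}\Bigr)(\tau,z_1,z_2)=(c\tau+d)^{-1}e^{-\frac{2\pi i mc z_1z_2}{c\tau+d}}\,F\Bigl(\frac{a\tau+b}{c\tau+d},\frac{z_1}{c\tau+d},\frac{z_2}{c\tau+d}\Bigr).$$ Let $T=\left(\begin{smallmatrix}1&1\\0&1\end{smallmatrix}\right)$ and $S=\left(\begin{smallmatrix}0&-1\\1&0\end{smallmatrix}\right)$. **Corollary 1.4.** Let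 $m\in\frac12\mathbb Z_{>0}$. (a) If $s,s_1\in\frac12\mathbb Z$ and $s-s_1\in\mathbb Z$, then $\widetilde\Phi^{+[m;s]}=\widetilde\Phi^{+[m;s_1]}$ and $\widetilde\Phi^{-[m;s]}=\widetilde\Phi^{-[m;s_1]}$. (b) Let $s\in\mathbb Z$ and $s'\in\frac12+\mathbb Z$. The four functions $\widetilde\Phi^{+[m;s]}$, $\widetilde\Phi^{+[m;s']}$, $\widetilde\Phi^{-[m;s]}$, $\widetilde\Phi^{-[m;s']}$ are pairwise distinct and are permuted by the above action of $SL_2(\mathbb Z)$. Moreover: - If $m\in\mathbb Z_{>0}$, then $\widetilde\Phi^{+[m;s]}$ is fixed by $SL_2(\mathbb Z)$; $T$ fixes $\widetilde\Phi^{-[m;s]}$ and transposes $\widetilde\Phi^{+[m;s']}$ and $\widetilde\Phi^{-[m;s']}$; $S$ fixes $\widetilde\Phi^{-[m;s']}$ and transposes $\widetilde\Phi^{-[m;s]}$ and $\widetilde\Phi^{+[m;s']}$. - If $m\in\frac12+\mathbb Z_{\ge0}$, then $\widetilde\Phi^{-[m;s']}$ is fixed by $SL_2(\mathbb Z)$;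 $T$ fixes $\widetilde\Phi^{+[m;s']}$ and transposes $\widetilde\Phi^{+[m;s]}$ and $\widetilde\Phi^{-[m;s]}$; $S$ fixes $\widetilde\Phi^{+[m;s]}$ and transposes $\widetilde\Phi^{-[m;s]}$ and $\widetilde\Phi^{+[m;s']}$. -/

import Mathlib

open scoped UpperHalfPlane MatrixGroups

namespace MockTheta

noncomputable section

/-- `e(x) = exp(2πi x)`; in particular `q ^ r = e(r τ)`. -/
def e (x : ℂ) : ℂ := Complex.exp (2 * Real.pi * Complex.I * x)

/-- The sign `(±1)ⁿ` as a complex number. -/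
def sgnPow (ε : ℤˣ) (n : ℤ) : ℂ := (((ε ^ n : ℤˣ) : ℤ) : ℂ)

/-- The signed mock theta function
`Φ^{±[m;s]}(τ, z₁, z₂) = ∑ₙ (±1)ⁿ e^{2πi m n (z₁+z₂) + 2πi s z₁} q^{m n² + s n} / (1 - e^{2πi z₁} qⁿ)`,
with poles exactly at `z₁ ∈ ℤ + τ ℤ`; the sign `±` is `ε`. -/
def Phi (ε : ℤˣ) (m s : ℝ) (τ : ℍ) (z₁ z₂ : ℂ) : ℂ :=
  ∑' n : ℤ, sgnPow ε n *
    (e (m * n * (z₁ + z₂) + s * z₁) * e ((m * n ^ 2 + s * n) * τ)) / (1 - e z₁ * e (n * τ))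

/-- The signed theta function
`Θ^±_{j,m}(τ, z) = ∑ₙ (±1)ⁿ e^{2πi m z (n + j/2m)} q^{m (n + j/2m)²}`. -/
def Theta (ε : ℤˣ) (j m : ℝ) (τ : ℍ) (z : ℂ) : ℂ :=
  ∑' n : ℤ, sgnPow ε n * (e (m * z * (n + j / (2 * m))) * e (m * (n + j / (2 * m)) ^ 2 * τ))

/-- `E(x) = 2 ∫₀ˣ e^{-π u²} du`. -/
def E (x : ℝ) : ℝ := 2 * ∫ u in (0 : ℝ)..x, Real.exp (-Real.pi * u ^ 2)

/-- `ψ_{m,n}(τ, z) = (n - 2m Im z / Im τ) √(Im τ / m)`. -/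
def psi (m n : ℝ) (τ : ℍ) (z : ℂ) : ℝ := (n - 2 * m * (z.im / τ.im)) * Real.sqrt (τ.im / m)

/-- The term of the series `R^±_{j,m}` of index `n`, without its sign `(±1)^{(n-j)/2m}`. -/
def RTerm (j m n : ℝ) (τ : ℍ) (z : ℂ) : ℂ :=
  ((Real.sign (n - 1 / 2 - j + 2 * m) - E (psi m n τ z) : ℝ) : ℂ) *
    Complex.exp (-(Real.pi * Complex.I * n ^ 2 / (2 * m)) * τ + 2 * Real.pi * Complex.I * n * z)

/-- The series `R^±_{j,m}(τ, z)` over all `n ≡ j mod 2m`, written as `n = j + 2 m k` with `k ∈ ℤ`,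
the sign `(±1)^{(n-j)/2m}` being `(±1)ᵏ`. -/
def R (ε : ℤˣ) (j m : ℝ) (τ : ℍ) (z : ℂ) : ℂ :=
  ∑' k : ℤ, sgnPow ε k * RTerm j m (j + 2 * m * k) τ z

/-- The modifier: the sum of `R^±_{j,m}(τ, (z₁ - z₂)/2) Θ^±_{j,m}(τ, z₁ + z₂)` over all
`j ∈ s + ℤ` with `s ≤ j < s + 2m`, i.e. `j = s + k` with `k` an integer, `0 ≤ k < 2m`. -/
def PhiAdd (ε : ℤˣ) (m s : ℝ) (τ : ℍ) (z₁ z₂ : ℂ) : ℂ :=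
  ∑ k ∈ Finset.range ⌈2 * m⌉₊,
    R ε (s + k) m τ ((z₁ - z₂) / 2) * Theta ε (s + k) m τ (z₁ + z₂)

/-- The common domain of all the functions `Φ^{±[m;s]}`: the points `(τ, z₁, z₂)` with
`Im τ > 0` that do not lie on the polar divisor `z₁ ∈ ℤ + τ ℤ`. -/
def Domain : Type := {p : ℍ × ℂ × ℂ // ∀ a b : ℤ, p.2.1 ≠ a + b * (p.1 : ℂ)}

/-- The modified signed mock theta function `Φ̃^{±[m;s]} = Φ^{±[m;s]} - ½ Φ_add^{±[m;s]}`. -/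
def PhiTilde (ε : ℤˣ) (m s : ℝ) : Domain → ℂ := fun p =>
  Phi ε m s p.1.1 p.1.2.1 p.1.2.2 - 1 / 2 * PhiAdd ε m s p.1.1 p.1.2.1 p.1.2.2

lemma denom_ne (γ : SL(2, ℤ)) (τ : ℍ) : ((γ 1 0 : ℂ) * τ + γ 1 1) ≠ 0 := by
  simpa [UpperHalfPlane.denom] using UpperHalfPlane.denom_ne_zero (γ : GL (Fin 2) ℝ) τ

/-- The action `(τ, z₁, z₂) ↦ ((aτ+b)/(cτ+d), z₁/(cτ+d), z₂/(cτ+d))` on `Domain`. -/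
def act (γ : SL(2, ℤ)) (p : Domain) : Domain :=
  ⟨(γ • p.1.1, p.1.2.1 / ((γ 1 0 : ℂ) * p.1.1 + γ 1 1), p.1.2.2 / ((γ 1 0 : ℂ) * p.1.1 + γ 1 1)), by
    intro a b h
    have hd := denom_ne γ p.1.1
    have hτ := UpperHalfPlane.coe_specialLinearGroup_apply γ p.1.1
    simp only [algebraMap_int_eq, eq_intCast, Complex.ofReal_intCast] at hτ
    simp only at h
    rw [hτ, div_eq_iff hd, add_mul, mul_assoc (b : ℂ), div_mul_cancel₀ _ hd] at h
    apply p.2 (a * γ 1 1 + b * γ 0 1) (a * γ 1 0 + b * γ 0 0)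
    rw [h]
    push_cast
    ring⟩

/-- The right action of weight `1` and degree `m` on functions:
`(F|γ)(τ, z₁, z₂) = (cτ+d)⁻¹ e^{-2πi m c z₁ z₂ / (cτ+d)} F(γ · (τ, z₁, z₂))`. -/
def slash (m : ℝ) (γ : SL(2, ℤ)) (F : Domain → ℂ) : Domain → ℂ := fun p =>
  ((γ 1 0 : ℂ) * p.1.1 + γ 1 1)⁻¹ *
    e (-(m * γ 1 0 * p.1.2.1 * p.1.2.2 / ((γ 1 0 : ℂ) * p.1.1 + γ 1 1))) * F (act γ p)

/-- The list `Φ̃^{+[m;s]}, Φ̃^{+[m;s']}, Φ̃^{-[m;s]}, Φ̃^{-[m;s']}`. -/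
def fourFunctions (m s s' : ℝ) : Fin 4 → Domain → ℂ :=
  ![PhiTilde 1 m s, PhiTilde 1 m s', PhiTilde (-1) m s, PhiTilde (-1) m s']

end

end MockTheta

open MockTheta

namespace MockTheta

open Filter Topology MeasureTheory Set FourierTransform ComplexConjugate

/-! ### The error function `E` -/

/-! The completed function is, up to an elementary factor, a Kronecker–Eisenstein series over the
period lattice: a sum of terms `χ(n, k) exp(…) / W` with `W = z₁ + nτ + k` and a Gaussian in `|W|`
(`PhiTilde_eq_kronecker`). Here `χ(n, k) = (-1)^(αn + βk + μnk)`, where `α` records the sign `±`, `β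
≡ 2s` and `μ ≡ 2m` modulo 2. Since `s` enters only through `2s` mod 2, part (a) follows.

To get there, write the modifier as a double series over `(l, n)`. For fixed `n` the sum over `l`
turns the geometric series of `1 / (1 - e(w))`, `w = z₁ + nτ`, into a series with step function
smoothed by `E`. Poisson summation converts that into Gaussian-damped simple poles at the integers
(`cotangent_expansion`).

A modular substitution permutes the lattice and preserves the terms up to the weight and index
factors, so it acts only on `(α, β)` by an affine map modulo 2 (`slash_kroneckerSeries`). The stated
permutations are then arithmetic in `ZMod 2`. Distinctness holds because the polar part at each
lattice point reveals the value of `χ` there (`latticeSign_eq_of_kroneckerSeries_eq`). -/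

lemma continuous_gaussian : Continuous fun u : ℝ => Real.exp (-Real.pi * u ^ 2) := by fun_prop

lemma hasDerivAt_E (x : ℝ) : HasDerivAt E (2 * Real.exp (-Real.pi * x ^ 2)) x :=
  (intervalIntegral.integral_hasDerivAt_right
    (continuous_gaussian.intervalIntegrable _ _)
    continuous_gaussian.stronglyMeasurable.stronglyMeasurableAtFilter
    continuous_gaussian.continuousAt).const_mul 2

lemma E_neg (x : ℝ) : E (-x) = -E x := by
  have h := intervalIntegral.integral_comp_neg (a := 0) (b := x)
    (fun u : ℝ => Real.exp (-Real.pi * u ^ 2))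
  simp only [neg_sq, neg_zero] at h
  rw [E, E, h, intervalIntegral.integral_symm]
  ring

lemma one_sub_E_eq {x : ℝ} : 1 - E x = 2 * ∫ u in Ioi x, Real.exp (-Real.pi * u ^ 2) := by
  have hi : Integrable fun u : ℝ => Real.exp (-Real.pi * u ^ 2) :=
    integrable_exp_neg_mul_sq Real.pi_pos
  have h1 := intervalIntegral.integral_Ioi_sub_Ioi' (μ := volume) (a := 0) (b := x)
    (f := fun u : ℝ => Real.exp (-Real.pi * u ^ 2)) hi.integrableOn hi.integrableOn
  have h2 := integral_gaussian_Ioi Real.pi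
  rw [div_self Real.pi_pos.ne', Real.sqrt_one] at h2
  rw [E, ← h1, h2]
  ring

lemma one_sub_E_nonneg (x : ℝ) : 0 ≤ 1 - E x := by
  rw [one_sub_E_eq]
  have : 0 ≤ ∫ u in Ioi x, Real.exp (-Real.pi * u ^ 2) :=
    integral_nonneg fun u => (Real.exp_pos _).le
  linarith

/-- After the shift `u ↦ u + x` the cross term `2ux` is nonnegative, so a factor `exp(-πx²)` comes
out of the Gaussian tail. -/
lemma one_sub_E_le {x : ℝ} (hx : 0 ≤ x) : 1 - E x ≤ Real.exp (-Real.pi * x ^ 2) := by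
  have hi : Integrable fun u : ℝ => Real.exp (-Real.pi * u ^ 2) :=
    integrable_exp_neg_mul_sq Real.pi_pos
  have h2 := integral_gaussian_Ioi Real.pi
  rw [div_self Real.pi_pos.ne', Real.sqrt_one] at h2
  have h1 : ∫ u in Ioi x, Real.exp (-Real.pi * u ^ 2) =
      ∫ u in Ioi (0 : ℝ), Real.exp (-Real.pi * (u + x) ^ 2) := by
    have := (measurePreserving_add_right volume x).setIntegral_preimage_emb
      (measurableEmbedding_addRight x) (fun u => Real.exp (-Real.pi * u ^ 2)) (Ioi x)
    rw [← this]
    simp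
  have h3 : ∫ u in Ioi (0 : ℝ), Real.exp (-Real.pi * (u + x) ^ 2) ≤
      ∫ u in Ioi (0 : ℝ), Real.exp (-Real.pi * x ^ 2) * Real.exp (-Real.pi * u ^ 2) := by
    refine setIntegral_mono_on (hi.comp_add_right x).integrableOn
      (hi.const_mul _).integrableOn measurableSet_Ioi fun u hu => ?_
    rw [← Real.exp_add, Real.exp_le_exp]
    have hu' : 0 ≤ u * x := mul_nonneg (le_of_lt hu) hx
    nlinarith [mul_nonneg Real.pi_pos.le hu']
  rw [integral_const_mul, h2] at h3
  rw [one_sub_E_eq, h1]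
  linarith

lemma one_add_E_nonneg (x : ℝ) : 0 ≤ 1 + E x := by
  simpa [E_neg] using one_sub_E_nonneg (-x)

lemma one_add_E_le {x : ℝ} (hx : x ≤ 0) : 1 + E x ≤ Real.exp (-Real.pi * x ^ 2) := by
  simpa [E_neg] using one_sub_E_le (x := -x) (by linarith)

/-- The sign of an integer, with `0` counted as positive. -/
def intSign (l : ℤ) : ℝ := if 0 ≤ l then 1 else -1

lemma abs_intSign_sub_E_le {κ : ℝ} (hκ : 0 < κ) (c : ℝ) (l : ℤ) :
    |intSign l - E (κ * (l - c))| ≤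
      2 * Real.exp (Real.pi * κ ^ 2 * c ^ 2) * Real.exp (-Real.pi * κ ^ 2 * (l - c) ^ 2) := by
  -- For `l` between `0` and `c` the tail bound is unavailable. There `(l - c)² ≤ c²`, and the
  -- constant `exp(πκ²c²)` makes the right side at least the trivial bound 2.
  have key : ∀ (y x : ℝ), 0 ≤ y → y ≤ 2 →
      (y ≤ Real.exp (-Real.pi * x ^ 2) ∨ x ^ 2 ≤ κ ^ 2 * c ^ 2) →
      y ≤ 2 * Real.exp (Real.pi * κ ^ 2 * c ^ 2) * Real.exp (-Real.pi * x ^ 2) := by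
    intro y x h0 h2 h
    rcases h with h | h
    · have h1 : 1 ≤ Real.exp (Real.pi * κ ^ 2 * c ^ 2) := Real.one_le_exp (by positivity)
      nlinarith [Real.exp_pos (-Real.pi * x ^ 2)]
    · rw [mul_assoc, ← Real.exp_add]
      have h1 : 1 ≤ Real.exp (Real.pi * κ ^ 2 * c ^ 2 + -Real.pi * x ^ 2) :=
        Real.one_le_exp (by nlinarith [Real.pi_pos])
      linarith
  have hE1 := one_sub_E_nonneg (κ * (l - c))
  have hE2 := one_add_E_nonneg (κ * (l - c))
  rw [show -Real.pi * κ ^ 2 * ((l : ℝ) - c) ^ 2 = -Real.pi * (κ * (l - c)) ^ 2 by ring]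
  unfold intSign
  split_ifs with hl
  · have hl' : (0 : ℝ) ≤ l := by exact_mod_cast hl
    rw [abs_of_nonneg hE1]
    refine key _ _ hE1 (by linarith) ?_
    rcases le_total c l with h | h
    · exact Or.inl (one_sub_E_le (mul_nonneg hκ.le (by linarith)))
    · refine Or.inr ?_
      rw [mul_pow]
      exact mul_le_mul_of_nonneg_left (by nlinarith) (sq_nonneg κ)
  · have hl' : (l : ℝ) < 0 := by exact_mod_cast not_le.1 hl
    rw [show -1 - E (κ * (l - c)) = -(1 + E (κ * (l - c))) by ring, abs_neg, abs_of_nonneg hE2]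
    refine key _ _ hE2 (by linarith) ?_
    rcases le_total (l : ℝ) c with h | h
    · exact Or.inl (one_add_E_le (mul_nonpos_of_nonneg_of_nonpos hκ.le (by linarith)))
    · refine Or.inr ?_
      rw [mul_pow]
      exact mul_le_mul_of_nonneg_left (by nlinarith) (sq_nonneg κ)

lemma summable_gaussian {a : ℝ} (ha : 0 < a) (b d : ℝ) :
    Summable fun n : ℤ => Real.exp (-a * n ^ 2 + b * |(n : ℝ)| + d) := by
  have h := summable_pow_mul_jacobiTheta₂_term_bound (b / (2 * Real.pi)) (div_pos ha Real.pi_pos) 0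
  refine (h.mul_left (Real.exp d)).congr fun n => ?_
  rw [pow_zero, one_mul, ← Real.exp_add]
  congr 1
  push_cast
  field_simp
  ring

lemma summable_gaussian_linear {a : ℝ} (ha : 0 < a) (b d : ℝ) :
    Summable fun n : ℤ => Real.exp (-a * n ^ 2 + b * n + d) :=
  (summable_gaussian ha |b| d).of_nonneg_of_le (fun _ => (Real.exp_pos _).le) fun n =>
    Real.exp_le_exp.2 (by have := le_abs_self (b * n); rw [abs_mul] at this; linarith)

/-! ### The exponential `e` -/

lemma norm_e (x : ℂ) : ‖e x‖ = Real.exp (-2 * Real.pi * x.im) := by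
  rw [e, Complex.norm_exp]
  congr 1
  simp

lemma e_add (x y : ℂ) : e (x + y) = e x * e y := by
  rw [e, e, e, ← Complex.exp_add]; ring_nf

lemma e_ne_zero (x : ℂ) : e x ≠ 0 := Complex.exp_ne_zero _

lemma e_eq_one_iff {x : ℂ} : e x = 1 ↔ ∃ n : ℤ, x = n := by
  rw [e, Complex.exp_eq_one_iff]
  refine exists_congr fun n => ?_
  rw [mul_comm (n : ℂ), mul_right_inj' Complex.two_pi_I_ne_zero]

lemma e_intCast (n : ℤ) : e n = 1 := e_eq_one_iff.2 ⟨n, rfl⟩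

lemma e_nat_mul (n : ℕ) (w : ℂ) : e (n * w) = e w ^ n := by
  rw [e, e, ← Complex.exp_nat_mul]; ring_nf

lemma differentiable_e : Differentiable ℂ e := by unfold e; fun_prop

lemma hasDerivAt_e_mul (a : ℂ) (x : ℝ) :
    HasDerivAt (fun x : ℝ => e (x * a)) (2 * Real.pi * Complex.I * a * e (x * a)) x := by
  have h : HasDerivAt (fun x : ℝ => 2 * Real.pi * Complex.I * ((x : ℂ) * a))
      (2 * Real.pi * Complex.I * a) x := by
    simpa using ((hasDerivAt_id (x : ℝ)).ofReal_comp.mul_const a).const_mul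
      (2 * Real.pi * Complex.I)
  simpa only [e, mul_comm (Complex.exp _)] using! h.cexp

/-! ### Fourier transform and Poisson summation for the smoothed exponential -/

/-- The Gaussian decay at `-∞` beats every exponential rate `A`, by completing the square. This is
what defeats the growth of `e(xw)` as `x → -∞`. -/
lemma one_add_E_le_exp {A : ℝ} (hA : 0 < A) (u : ℝ) :
    1 + E u ≤ 2 * Real.exp (A ^ 2 / (4 * Real.pi)) * Real.exp (A * u) := by
  have h1 : 1 ≤ Real.exp (A ^ 2 / (4 * Real.pi)) :=
    Real.one_le_exp (by have := Real.pi_pos; positivity)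
  rcases le_total 0 u with hu | hu
  · have h2 : 1 ≤ Real.exp (A * u) := Real.one_le_exp (by positivity)
    have := one_sub_E_nonneg u
    nlinarith
  · refine (one_add_E_le hu).trans ?_
    have h2 : Real.exp (-Real.pi * u ^ 2) ≤ Real.exp (A ^ 2 / (4 * Real.pi)) * Real.exp (A * u) := by
      rw [← Real.exp_add, Real.exp_le_exp]
      have hp := Real.pi_pos
      have h3 : A ^ 2 / (4 * Real.pi) + A * u + Real.pi * u ^ 2 =
          (A + 2 * Real.pi * u) ^ 2 / (4 * Real.pi) := by field_simp; ring
      have h4 : 0 ≤ (A + 2 * Real.pi * u) ^ 2 / (4 * Real.pi) := by positivity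
      linarith
    nlinarith [Real.exp_pos (A ^ 2 / (4 * Real.pi) + A * u),
      Real.exp_pos (A ^ 2 / (4 * Real.pi)), Real.exp_pos (A * u),
      mul_pos (Real.exp_pos (A ^ 2 / (4 * Real.pi))) (Real.exp_pos (A * u))]

lemma exp_neg_mul_abs_le {a : ℝ} (ha : 0 < a) (x : ℝ) :
    Real.exp (-a * |x|) ≤ (1 + 2 / a ^ 2) * (1 + x ^ 2)⁻¹ := by
  have h := Real.quadratic_le_exp_of_nonneg (x := a * |x|) (by positivity)
  have h1 : 1 + x ^ 2 ≤ (1 + 2 / a ^ 2) * Real.exp (a * |x|) := by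
    have h2 : (1 + 2 / a ^ 2) * (1 + (a * |x|) ^ 2 / 2) ≤ (1 + 2 / a ^ 2) * Real.exp (a * |x|) := by
      have : 0 ≤ a * |x| := by positivity
      gcongr
      linarith
    refine le_trans ?_ h2
    rw [mul_pow, sq_abs]
    have : (1 + 2 / a ^ 2) * (1 + a ^ 2 * x ^ 2 / 2) =
      1 + x ^ 2 + (2 / a ^ 2 + a ^ 2 * x ^ 2 / 2) := by field_simp; ring
    rw [this]
    have : 0 ≤ 2 / a ^ 2 + a ^ 2 * x ^ 2 / 2 := by positivity
    linarith
  rw [← div_eq_mul_inv, le_div_iff₀ (by positivity), neg_mul, Real.exp_neg,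
    inv_mul_le_iff₀ (Real.exp_pos _)]
  linarith

/-- The smooth step function `½ (1 + E(κ (x - c)))`. -/
noncomputable def smoothStep (κ c x : ℝ) : ℂ := ((1 + E (κ * (x - c))) / 2 : ℝ)

lemma hasDerivAt_smoothStep (κ c x : ℝ) :
    HasDerivAt (smoothStep κ c) (κ * Real.exp (-Real.pi * (κ * (x - c)) ^ 2) : ℝ) x := by
  have h : HasDerivAt (fun x : ℝ => κ * (x - c)) κ x := by
    simpa using ((hasDerivAt_id x).sub_const c).const_mul κ
  have h2 := (((hasDerivAt_E (κ * (x - c))).comp x h).const_add 1).div_const 2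
  have h3 := h2.ofReal_comp
  convert! h3 using 1
  push_cast
  ring

lemma continuous_smoothStep (κ c : ℝ) : Continuous (smoothStep κ c) :=
  continuous_iff_continuousAt.2 fun x => (hasDerivAt_smoothStep κ c x).continuousAt

lemma norm_smoothStep_mul_le {κ : ℝ} (hκ : 0 < κ) (c : ℝ) {w : ℂ} (hw : 0 < w.im) :
    ∃ K : ℝ, ∀ x : ℝ, ‖smoothStep κ c x * e (x * w)‖ ≤ K * (1 + x ^ 2)⁻¹ := by
  -- The rate `Aκ = 4π Im w` is twice the growth rate of `|e(xw)|` at `-∞`, so decay at rate `2π Im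
  -- w` remains on both sides.
  set A : ℝ := 4 * Real.pi * w.im / κ with hA
  have hp := Real.pi_pos
  have hA0 : 0 < A := by positivity
  set C : ℝ := Real.exp (A ^ 2 / (4 * Real.pi)) * Real.exp (A * κ * |c|) with hC
  have hC1 : 1 ≤ C := by
    rw [hC, ← Real.exp_add]
    exact Real.one_le_exp (by positivity)
  refine ⟨C * (1 + 2 / (2 * Real.pi * w.im) ^ 2), fun x => ?_⟩
  rw [mul_assoc]
  refine le_trans ?_ (mul_le_mul_of_nonneg_left
    (exp_neg_mul_abs_le (a := 2 * Real.pi * w.im) (by positivity) x) (by linarith))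
  have h1 := one_sub_E_nonneg (κ * (x - c))
  have h2 := one_add_E_nonneg (κ * (x - c))
  have him : ((x : ℂ) * w).im = x * w.im := by simp
  rw [norm_mul, norm_e, him, smoothStep, Complex.norm_of_nonneg (by linarith)]
  rcases le_total 0 x with hx | hx
  · rw [abs_of_nonneg hx, show -2 * Real.pi * (x * w.im) = -(2 * Real.pi * w.im) * x by ring]
    exact mul_le_mul_of_nonneg_right (by linarith) (Real.exp_pos _).le
  · have h3 := one_add_E_le_exp hA0 (κ * (x - c))
    rw [abs_of_nonpos hx]
    have h4 : (1 + E (κ * (x - c))) / 2 ≤ C * Real.exp (4 * Real.pi * w.im * x) := by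
      have : Real.exp (A ^ 2 / (4 * Real.pi)) * Real.exp (A * (κ * (x - c))) ≤
          C * Real.exp (4 * Real.pi * w.im * x) := by
        rw [hC, mul_assoc, ← Real.exp_add (A * κ * |c|)]
        refine mul_le_mul_of_nonneg_left (Real.exp_le_exp.2 ?_) (Real.exp_pos _).le
        have h5 : A * (κ * (x - c)) = 4 * Real.pi * w.im * x + A * κ * (-c) := by
          rw [hA]; field_simp; ring
        rw [h5]
        have := mul_le_mul_of_nonneg_left (neg_le_abs c) (show 0 ≤ A * κ by positivity)
        linarith
      linarith
    refine (mul_le_mul_of_nonneg_right h4 (Real.exp_pos _).le).trans ?_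
    rw [mul_assoc, ← Real.exp_add]
    refine mul_le_mul_of_nonneg_left (Real.exp_le_exp.2 ?_) (by linarith)
    linarith

lemma integrable_smoothStep_mul {κ : ℝ} (hκ : 0 < κ) (c : ℝ) {w : ℂ} (hw : 0 < w.im) :
    Integrable fun x : ℝ => smoothStep κ c x * e (x * w) := by
  obtain ⟨K, hK⟩ := norm_smoothStep_mul_le hκ c hw
  refine (integrable_inv_one_add_sq.const_mul K).mono' ?_ (ae_of_all _ hK)
  exact ((continuous_smoothStep κ c).mul
    (differentiable_e.continuous.comp (by fun_prop))).aestronglyMeasurable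

/-- The terms of the Gaussian-damped cotangent series. -/
noncomputable def poleTerm (κ c : ℝ) (w : ℂ) (k : ℤ) : ℂ :=
  e (c * (w - k)) * Complex.exp (-Real.pi * (w - k) ^ 2 / κ ^ 2) / (w - k)

/-- Integration by parts replaces the smooth step by its derivative, a Gaussian with an explicit
transform; the antiderivative of `e(xv)` supplies the pole `1 / v`. -/
lemma integral_smoothStep_mul {κ : ℝ} (hκ : 0 < κ) (c : ℝ) {v : ℂ} (hv : 0 < v.im) :
    ∫ x : ℝ, smoothStep κ c x * e (x * v) =
      -(1 / (2 * Real.pi * Complex.I)) *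
        (e (c * v) * Complex.exp (-Real.pi * v ^ 2 / κ ^ 2) / v) := by
  have hv0 : v ≠ 0 := by rintro rfl; simp at hv
  have hpi : (2 * Real.pi * Complex.I : ℂ) ≠ 0 := Complex.two_pi_I_ne_zero
  have hκ' : (κ : ℂ) ≠ 0 := by exact_mod_cast hκ.ne'
  have hderiv (x : ℝ) : HasDerivAt (fun x : ℝ => (2 * Real.pi * Complex.I * v)⁻¹ * e (x * v))
      (e (x * v)) x := by
    have := (hasDerivAt_e_mul v x).const_mul (2 * Real.pi * Complex.I * v)⁻¹
    rwa [← mul_assoc, inv_mul_cancel₀ (mul_ne_zero hpi hv0), one_mul] at this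
  have hgauss (x : ℝ) : ((κ * Real.exp (-Real.pi * (κ * (x - c)) ^ 2) : ℝ) : ℂ) *
      ((2 * Real.pi * Complex.I * v)⁻¹ * e (x * v)) =
      κ * (2 * Real.pi * Complex.I * v)⁻¹ * Complex.exp (-(Real.pi * κ ^ 2 : ℂ) * x ^ 2 +
        (2 * Real.pi * κ ^ 2 * c + 2 * Real.pi * Complex.I * v) * x + -(Real.pi * κ ^ 2 * c ^ 2)) := by
    rw [e]
    push_cast
    rw [mul_mul_mul_comm, ← Complex.exp_add]
    congr 2
    ring
  have hb : 0 < (Real.pi * κ ^ 2 : ℂ).re := by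
    have : (Real.pi * κ ^ 2 : ℂ) = ((Real.pi * κ ^ 2 : ℝ) : ℂ) := by push_cast; rfl
    rw [this, Complex.ofReal_re]
    have := Real.pi_pos
    positivity
  have hi := integrable_smoothStep_mul hκ c hv
  rw [integral_mul_deriv_eq_deriv_mul_of_integrable
    (u' := fun x => ((κ * Real.exp (-Real.pi * (κ * (x - c)) ^ 2) : ℝ) : ℂ))
    (fun x _ => hasDerivAt_smoothStep κ c x) (fun x _ => hderiv x) hi]
  · simp_rw [hgauss]
    rw [integral_const_mul, integral_cexp_quadratic (by simpa using hb), neg_neg]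
    have h1 : ((Real.pi : ℂ) / (Real.pi * κ ^ 2)) ^ (1 / 2 : ℂ) = 1 / κ := by
      have : (Real.pi : ℂ) / (Real.pi * κ ^ 2) = ((1 / κ : ℝ) : ℂ) ^ 2 := by
        have := Real.pi_ne_zero
        push_cast
        field_simp
      rw [this, show (1 / 2 : ℂ) = ((2 : ℕ) : ℂ)⁻¹ by norm_num,
        Complex.pow_cpow_nat_inv two_ne_zero]
      · simp
      · rw [Complex.arg_ofReal_of_nonneg (by positivity)]
        linarith [Real.pi_pos]
      · rw [Complex.arg_ofReal_of_nonneg (by positivity)]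
        positivity
    have hpi' : (Real.pi : ℂ) ≠ 0 := by exact_mod_cast Real.pi_ne_zero
    have h2 : -(Real.pi * κ ^ 2 * c ^ 2 : ℂ) -
        (2 * Real.pi * κ ^ 2 * c + 2 * Real.pi * Complex.I * v) ^ 2 / (4 * -(Real.pi * κ ^ 2)) =
        2 * Real.pi * Complex.I * (c * v) + -Real.pi * v ^ 2 / κ ^ 2 := by
      field_simp
      ring_nf
      rw [Complex.I_sq]
      ring
    rw [h1, h2, Complex.exp_add, e]
    field_simp
  · have := (integrable_cexp_quadratic hb (2 * Real.pi * κ ^ 2 * c + 2 * Real.pi * Complex.I * v)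
      (-(Real.pi * κ ^ 2 * c ^ 2))).const_mul (κ * (2 * Real.pi * Complex.I * v)⁻¹ : ℂ)
    exact this.congr (ae_of_all _ fun x => (hgauss x).symm)
  · refine (hi.const_mul (2 * Real.pi * Complex.I * v)⁻¹).congr (ae_of_all _ fun x => ?_)
    simp only [Pi.mul_apply]
    ring

lemma fourier_smoothStep_mul {κ : ℝ} (hκ : 0 < κ) (c : ℝ) {w : ℂ} (hw : 0 < w.im) (k : ℤ) :
    𝓕 (fun x : ℝ => smoothStep κ c x * e (x * w)) (k : ℝ) =
      -(1 / (2 * Real.pi * Complex.I)) * poleTerm κ c w k := by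
  rw [Real.fourier_real_eq_integral_exp_smul, poleTerm,
    ← integral_smoothStep_mul hκ c (v := w - k) (by simpa using hw)]
  congr 1
  ext x
  rw [mul_sub, sub_eq_add_neg, e_add, e, e, smul_eq_mul]
  push_cast
  ring_nf

/-! ### The damped cotangent expansion -/

/-- The bound depends on `w` only through `M` and `r`, so it serves both summability and locally
uniform convergence, hence holomorphy. -/
lemma norm_poleTerm_le {κ c : ℝ} (hκ : 0 < κ) {M r : ℝ} (hr : 0 < r) {w : ℂ} (hw : ‖w‖ ≤ M)
    (k : ℤ) (hk : r ≤ ‖w - k‖) :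
    ‖poleTerm κ c w k‖ ≤ r⁻¹ * Real.exp (-(Real.pi / κ ^ 2) * k ^ 2 +
      2 * Real.pi * M / κ ^ 2 * |(k : ℝ)| + (2 * Real.pi * |c| * M + Real.pi * M ^ 2 / κ ^ 2)) := by
  have hp := Real.pi_pos
  have hre : |w.re| ≤ M := (Complex.abs_re_le_norm w).trans hw
  have him : |w.im| ≤ M := (Complex.abs_im_le_norm w).trans hw
  have hM : 0 ≤ M := (abs_nonneg _).trans hre
  rw [poleTerm, norm_div, norm_mul, norm_e, Complex.norm_exp, ← Real.exp_add, div_eq_inv_mul]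
  have h1 : (-(Real.pi : ℂ) * (w - k) ^ 2 / κ ^ 2).re =
      -(Real.pi / κ ^ 2) * ((w.re - k) ^ 2 - w.im ^ 2) := by
    have : (-(Real.pi : ℂ) * (w - k) ^ 2 / κ ^ 2) =
      ((-(Real.pi / κ ^ 2) : ℝ) : ℂ) * (w - k) ^ 2 := by push_cast; ring
    rw [this, Complex.re_ofReal_mul, sq (w - (k : ℂ)), Complex.mul_re]
    simp only [Complex.sub_re, Complex.intCast_re, Complex.sub_im, Complex.intCast_im, sub_zero]
    ring
  have h2 : ((c : ℂ) * (w - k)).im = c * w.im := by simp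
  rw [h1, h2]
  refine mul_le_mul (inv_anti₀ hr hk) (Real.exp_le_exp.2 ?_) (Real.exp_pos _).le (by positivity)
  have h3 : -(c * w.im) ≤ |c| * M := by
    refine (neg_le_abs _).trans ?_
    rw [abs_mul]
    exact mul_le_mul_of_nonneg_left him (abs_nonneg _)
  have h4 : w.im ^ 2 ≤ M ^ 2 := by rw [← sq_abs w.im]; gcongr
  have h5 : w.re * k ≤ M * |(k : ℝ)| := by
    refine (le_abs_self _).trans ?_
    rw [abs_mul]
    exact mul_le_mul_of_nonneg_right hre (abs_nonneg _)
  have h6 : -((w.re - k) ^ 2 - w.im ^ 2) ≤ -(k : ℝ) ^ 2 + 2 * M * |(k : ℝ)| + M ^ 2 := by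
    nlinarith [sq_nonneg w.re]
  have h7 := mul_le_mul_of_nonneg_left h6 (show 0 ≤ Real.pi / κ ^ 2 by positivity)
  have h8 := mul_le_mul_of_nonneg_left h3 (show 0 ≤ 2 * Real.pi by positivity)
  calc _ = 2 * Real.pi * -(c * w.im) + Real.pi / κ ^ 2 * -((w.re - k) ^ 2 - w.im ^ 2) := by ring
    _ ≤ _ := add_le_add h8 h7
    _ = _ := by ring

/-- The terms of the correction to the geometric series. -/
noncomputable def errorTerm (κ c : ℝ) (w : ℂ) (l : ℤ) : ℂ :=
  ((intSign l - E (κ * (l - c)) : ℝ) : ℂ) * e (l * w)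

lemma norm_errorTerm_le {κ c : ℝ} (hκ : 0 < κ) {M : ℝ} {w : ℂ} (hw : ‖w‖ ≤ M) (l : ℤ) :
    ‖errorTerm κ c w l‖ ≤ 2 * Real.exp (Real.pi * κ ^ 2 * c ^ 2) *
      Real.exp (-(Real.pi * κ ^ 2) * l ^ 2 +
        (2 * Real.pi * κ ^ 2 * |c| + 2 * Real.pi * M) * |(l : ℝ)| + 0) := by
  have hp := Real.pi_pos
  have him : |w.im| ≤ M := (Complex.abs_im_le_norm w).trans hw
  rw [errorTerm, norm_mul, norm_e, Complex.norm_real, Real.norm_eq_abs]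
  refine (mul_le_mul_of_nonneg_right (abs_intSign_sub_E_le hκ c l) (Real.exp_pos _).le).trans ?_
  rw [mul_assoc, ← Real.exp_add]
  refine mul_le_mul_of_nonneg_left (Real.exp_le_exp.2 ?_) (by positivity)
  have h1 : ((l : ℂ) * w).im = l * w.im := by simp
  rw [h1]
  have h2 : -(l * w.im) ≤ M * |(l : ℝ)| := by
    refine (neg_le_abs _).trans ?_
    rw [abs_mul, mul_comm]
    exact mul_le_mul_of_nonneg_right him (abs_nonneg _)
  have h3 : l * c ≤ |c| * |(l : ℝ)| := by
    refine (le_abs_self _).trans ?_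
    rw [abs_mul, mul_comm]
  have h4 : -((l : ℝ) - c) ^ 2 ≤ -(l : ℝ) ^ 2 + 2 * (|c| * |(l : ℝ)|) := by
    nlinarith [sq_nonneg c]
  have h7 := mul_le_mul_of_nonneg_left h4 (show 0 ≤ Real.pi * κ ^ 2 by positivity)
  have h8 := mul_le_mul_of_nonneg_left h2 (show 0 ≤ 2 * Real.pi by positivity)
  calc _ = Real.pi * κ ^ 2 * -((l : ℝ) - c) ^ 2 + 2 * Real.pi * -(l * w.im) := by ring
    _ ≤ _ := add_le_add h7 h8
    _ = _ := by ring

lemma summable_errorTerm {κ : ℝ} (hκ : 0 < κ) (c : ℝ) (w : ℂ) : Summable (errorTerm κ c w) :=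
  Summable.of_norm_bounded ((summable_gaussian (mul_pos Real.pi_pos (sq_pos_of_pos hκ)) _ _).mul_left _)
    (norm_errorTerm_le hκ le_rfl)

lemma isClosed_range_intCast : IsClosed (range ((↑) : ℤ → ℂ)) := by
  have := (Complex.isometry_ofReal.isClosedEmbedding.comp Real.isClosedEmbedding_intCast).isClosed_range
  simpa [Function.comp_def] using this

lemma exists_le_norm_sub_intCast {w₀ : ℂ} (hw₀ : ∀ k : ℤ, w₀ ≠ k) :
    ∃ r : ℝ, 0 < r ∧ ∀ w ∈ Metric.ball w₀ r, ∀ k : ℤ, r ≤ ‖w - k‖ := by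
  have h : (range ((↑) : ℤ → ℂ))ᶜ ∈ 𝓝 w₀ := isClosed_range_intCast.isOpen_compl.mem_nhds
    (by rintro ⟨k, hk⟩; exact hw₀ k hk.symm)
  obtain ⟨r, hr, hball⟩ := Metric.mem_nhds_iff.1 h
  refine ⟨r / 2, by positivity, fun w hw k => ?_⟩
  by_contra! hlt
  refine hball (a := (k : ℂ)) ?_ ⟨k, rfl⟩
  rw [Metric.mem_ball, dist_eq_norm] at hw ⊢
  calc ‖(k : ℂ) - w₀‖ = ‖(w - w₀) - (w - k)‖ := by ring_nf
    _ ≤ ‖w - w₀‖ + ‖w - k‖ := norm_sub_le _ _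
    _ < r := by linarith

lemma summable_poleTerm {κ : ℝ} (hκ : 0 < κ) (c : ℝ) {w : ℂ} (hw : ∀ k : ℤ, w ≠ k) :
    Summable (poleTerm κ c w) := by
  obtain ⟨r, hr, h⟩ := exists_le_norm_sub_intCast hw
  have hp := Real.pi_pos
  exact Summable.of_norm_bounded ((summable_gaussian (by positivity) _ _).mul_left _) fun k =>
    norm_poleTerm_le hκ hr le_rfl k (h w (Metric.mem_ball_self hr) k)

/-- Here `1 / (1 - e w)` is the geometric series over `l ≥ 0`, and the correction turns its sharp
cutoff into `smoothStep`. The identity is Poisson summation for `smoothStep κ c x * e (x * w)`. -/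
lemma cotangent_expansion_of_im_pos {κ : ℝ} (hκ : 0 < κ) (c : ℝ) {w : ℂ} (hw : 0 < w.im) :
    1 / (1 - e w) + 1 / 2 * -∑' l, errorTerm κ c w l =
      -(1 / (2 * Real.pi * Complex.I)) * ∑' k, poleTerm κ c w k := by
  have hwk : ∀ k : ℤ, w ≠ k := by rintro k rfl; simp at hw
  obtain ⟨K, hK⟩ := norm_smoothStep_mul_le hκ c hw
  have hcont : Continuous fun x : ℝ => smoothStep κ c x * e (x * w) :=
    (continuous_smoothStep κ c).mul (differentiable_e.continuous.comp (by fun_prop))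
  have hO : (fun x : ℝ => smoothStep κ c x * e (x * w)) =O[cocompact ℝ] fun x => |x| ^ (-2 : ℝ) := by
    refine Asymptotics.IsBigO.of_bound |K| ?_
    filter_upwards [(Set.finite_singleton (0 : ℝ)).isCompact.compl_mem_cocompact] with x hx
    have hx0 : 0 < |x| := abs_pos.2 (by simpa using hx)
    refine (hK x).trans ?_
    have h0 : 0 ≤ (1 + x ^ 2)⁻¹ := by positivity
    have h1 : (1 + x ^ 2)⁻¹ ≤ ‖|x| ^ (-2 : ℝ)‖ := by
      rw [Real.norm_of_nonneg (by positivity), Real.rpow_neg hx0.le]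
      refine inv_anti₀ (by positivity) ?_
      rw [show (2 : ℝ) = ((2 : ℕ) : ℝ) by norm_num, Real.rpow_natCast, sq_abs]
      linarith
    exact mul_le_mul (le_abs_self K) h1 h0 (abs_nonneg K)
  have hP := Real.tsum_eq_tsum_fourier_of_rpow_decay_of_summable hcont one_lt_two hO (by
    simp_rw [fourier_smoothStep_mul hκ c hw]
    exact (summable_poleTerm hκ c hwk).mul_left _) 0
  simp only [fourier_smoothStep_mul hκ c hw, zero_add, QuotientAddGroup.mk_zero, fourier_eval_zero,
    mul_one, tsum_mul_left] at hP
  rw [← hP]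
  have hlt : ‖e w‖ < 1 := by
    rw [norm_e]
    have := Real.pi_pos
    exact Real.exp_lt_one_iff.2 (by nlinarith [mul_pos this hw])
  have hgeom : HasSum (fun l : ℤ => if 0 ≤ l then e (l * w) else 0) (1 / (1 - e w)) := by
    have h1 : HasSum (fun n : ℕ => e w ^ n) (1 / (1 - e w)) := by
      simpa using hasSum_geometric_of_norm_lt_one hlt
    have h2 : HasSum (fun _ : ℕ => (0 : ℂ)) 0 := hasSum_zero
    have := HasSum.of_nat_of_neg_add_one (f := fun l : ℤ => if 0 ≤ l then e (l * w) else 0)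
      (m := 1 / (1 - e w)) (m' := 0) (by simpa [e_nat_mul] using h1)
      (by
        convert h2 using 2 with n
        rw [if_neg (by omega)])
    simpa using this
  have hall : HasSum (fun l : ℤ => smoothStep κ c l * e (l * w))
      (1 / (1 - e w) + 1 / 2 * -∑' l, errorTerm κ c w l) := by
    convert! hgeom.add ((summable_errorTerm hκ c w).hasSum.neg.mul_left (1 / 2)) using 2 with l
    rw [errorTerm, smoothStep, intSign]
    split_ifs <;> push_cast <;> ring
  exact_mod_cast hall.tsum_eq.symm

/-- A Gaussian-damped form of the partial fraction expansion of the cotangent. -/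
theorem cotangent_expansion {κ : ℝ} (hκ : 0 < κ) (c : ℝ) {w : ℂ} (hw : ∀ k : ℤ, w ≠ k) :
    1 / (1 - e w) + 1 / 2 * -∑' l, errorTerm κ c w l =
      -(1 / (2 * Real.pi * Complex.I)) * ∑' k, poleTerm κ c w k := by
  have hp := Real.pi_pos
  -- With `c` frozen as an independent real parameter, both sides are holomorphic in `w` off the
  -- integers. That set is connected, being the complement of a countable set, so the identity
  -- extends from the upper half-plane.
  set U : Set ℂ := (range ((↑) : ℤ → ℂ))ᶜ with hU
  have hmem {z : ℂ} : z ∈ U ↔ ∀ k : ℤ, z ≠ k := by simp [hU, eq_comm]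
  have hopen : IsOpen U := isClosed_range_intCast.isOpen_compl
  have hconn : IsPreconnected U := ((countable_range _).isConnected_compl_of_one_lt_rank
    (by simp [Complex.rank_real_complex])).isPreconnected
  have hE : Differentiable ℂ fun z => ∑' l, errorTerm κ c z l := by
    intro z
    refine (Complex.differentiableOn_tsum_of_summable_norm (U := Metric.ball 0 (‖z‖ + 1))
      ((summable_gaussian (mul_pos hp (sq_pos_of_pos hκ)) _ _).mul_left _)
      (fun l => ?_) Metric.isOpen_ball
      (fun l x hx => norm_errorTerm_le hκ (M := ‖z‖ + 1) (mem_ball_zero_iff.1 hx).le l)).differentiableAt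
      (Metric.isOpen_ball.mem_nhds (by simp))
    unfold errorTerm
    exact ((differentiable_e.comp (by fun_prop)).const_mul _).differentiableOn
  have hG : DifferentiableOn ℂ (fun z => ∑' k, poleTerm κ c z k) U := by
    intro z hz
    obtain ⟨r, hr, h⟩ := exists_le_norm_sub_intCast (hmem.1 hz)
    refine (DifferentiableOn.differentiableAt (Complex.differentiableOn_tsum_of_summable_norm
      (U := Metric.ball z r) ((summable_gaussian (by positivity) _ _).mul_left _)
      (fun k => ?_) Metric.isOpen_ball
      (fun k x hx => norm_poleTerm_le hκ hr (M := ‖z‖ + r) ?_ k (h x hx k)))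
      (Metric.ball_mem_nhds z hr)).differentiableWithinAt
    · unfold poleTerm
      refine DifferentiableOn.div (Differentiable.differentiableOn
        ((differentiable_e.comp (by fun_prop)).mul (by fun_prop))) (by fun_prop) fun x hx hx0 => ?_
      have := h x hx k
      rw [hx0, norm_zero] at this
      linarith
    · have := norm_sub_norm_le x z
      rw [Metric.mem_ball, dist_eq_norm] at hx
      linarith
  have hL : DifferentiableOn ℂ (fun z => 1 / (1 - e z) + 1 / 2 * -∑' l, errorTerm κ c z l) U := by
    refine DifferentiableOn.add (DifferentiableOn.div (by fun_prop)
      (differentiable_e.const_sub 1).differentiableOn fun z hz h0 => ?_)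
      (hE.neg.const_mul _).differentiableOn
    obtain ⟨n, hn⟩ := e_eq_one_iff.1 (sub_eq_zero.1 h0).symm
    exact hmem.1 hz n hn
  have hI : Complex.I ∈ U := hmem.2 fun k hk => by simpa using congrArg Complex.im hk
  refine (hL.analyticOnNhd hopen).eqOn_of_preconnected_of_eventuallyEq
    ((hG.const_mul _).analyticOnNhd hopen) hconn hI ?_ (hmem.2 hw)
  filter_upwards [(isOpen_lt continuous_const Complex.continuous_im).mem_nhds
    (show (0 : ℝ) < Complex.I.im by simp)] with z hz
  exact cotangent_expansion_of_im_pos hκ c hz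

/-! ### The modifier as an absolutely convergent double series -/

lemma norm_sgnPow (ε : ℤˣ) (n : ℤ) : ‖sgnPow ε n‖ = 1 := by
  rcases Int.units_eq_one_or (ε ^ n) with h | h <;> simp [sgnPow, h]

lemma sgnPow_add (ε : ℤˣ) (n k : ℤ) : sgnPow ε (n + k) = sgnPow ε n * sgnPow ε k := by
  simp [sgnPow, zpow_add]

lemma sgnPow_mul_self (ε : ℤˣ) (n : ℤ) : sgnPow ε n * sgnPow ε n = 1 := by
  rcases Int.units_eq_one_or (ε ^ n) with h | h <;> simp [sgnPow, h]

/-- With `N = 2m` and `n = j + 2mk` this is the sign in `R`. At `k = -1` the argument is `-1/2`, so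
the jump lies exactly between `k = -1` and `k = 0`. -/
lemma sign_two_mul_sub_half {N : ℕ} (hN : 0 < N) (k : ℤ) :
    Real.sign ((N : ℝ) * k + N - 1 / 2) = intSign k := by
  have hN' : (1 : ℝ) ≤ N := by exact_mod_cast hN
  unfold intSign
  split_ifs with h
  · have : (0 : ℝ) ≤ k := by exact_mod_cast h
    exact Real.sign_of_pos (by nlinarith)
  · have : (k : ℝ) + 1 ≤ 0 := by exact_mod_cast (by omega : k + 1 ≤ 0)
    exact Real.sign_of_neg (by nlinarith)

lemma psi_eq {m : ℝ} (hm : 0 < m) (j k : ℝ) (τ : ℍ) (z : ℂ) :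
    psi m (j + 2 * m * k) τ z =
      (2 * m * Real.sqrt (τ.im / m)) * (k - (z.im / τ.im - j / (2 * m))) := by
  rw [psi]
  field_simp
  ring

lemma RTerm_eq {N : ℕ} (hN : 0 < N) {m : ℝ} (hm : m = N / 2) (j : ℝ) (k : ℤ) (τ : ℍ) (z : ℂ) :
    RTerm j m (j + 2 * m * k) τ z =
      ((intSign k - E (psi m (j + 2 * m * k) τ z) : ℝ) : ℂ) *
        e (-(j + 2 * m * k : ℝ) ^ 2 * τ / (4 * m) + (j + 2 * m * k : ℝ) * z) := by
  rw [RTerm, e, show j + 2 * m * k - 1 / 2 - j + 2 * m = (N : ℝ) * k + N - 1 / 2 by rw [hm]; ring,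
    sign_two_mul_sub_half hN]
  congr 2
  push_cast
  ring

/-- The exponential factor grows like `exp(2πm Im τ k²)`, but the difference from `E` decays like
`exp(-4πm Im τ k²)`, since `κ² = 4m Im τ`. -/
lemma summable_norm_RTerm {N : ℕ} (hN : 0 < N) {m : ℝ} (hm : m = N / 2) (ε : ℤˣ) (j : ℝ) (τ : ℍ)
    (z : ℂ) : Summable fun k : ℤ => ‖sgnPow ε k * RTerm j m (j + 2 * m * k) τ z‖ := by
  have hm0 : 0 < m := by rw [hm]; positivity
  have hy : 0 < τ.im := τ.im_pos
  have hp := Real.pi_pos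
  set c : ℝ := z.im / τ.im - j / (2 * m) with hc
  set κ : ℝ := 2 * m * Real.sqrt (τ.im / m) with hκ
  have hκ0 : 0 < κ := by positivity
  have hκ2 : κ ^ 2 = 4 * m * τ.im := by
    rw [hκ, mul_pow, Real.sq_sqrt (by positivity)]
    field_simp
    ring
  refine ((summable_gaussian_linear (a := 2 * Real.pi * m * τ.im) (by positivity)
    (8 * Real.pi * m * τ.im * c + 2 * Real.pi * (τ.im * j) - 4 * Real.pi * m * z.im)
    (-4 * Real.pi * m * τ.im * c ^ 2 + Real.pi * τ.im * j ^ 2 / (2 * m) -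
      2 * Real.pi * j * z.im)).mul_left
    (2 * Real.exp (Real.pi * κ ^ 2 * c ^ 2))).of_nonneg_of_le (fun _ => norm_nonneg _) fun k => ?_
  rw [norm_mul, norm_sgnPow, one_mul, RTerm_eq hN hm, norm_mul, Complex.norm_real, Real.norm_eq_abs,
    psi_eq hm0, norm_e]
  refine (mul_le_mul_of_nonneg_right (abs_intSign_sub_E_le hκ0 c k) (Real.exp_pos _).le).trans ?_
  rw [mul_assoc, ← Real.exp_add]
  refine mul_le_mul_of_nonneg_left (Real.exp_le_exp.2 (le_of_eq ?_)) (by positivity)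
  have him : (-(j + 2 * m * k : ℝ) ^ 2 * (τ : ℂ) / (4 * m) + (j + 2 * m * k : ℝ) * z).im =
      -(j + 2 * m * k) ^ 2 * τ.im / (4 * m) + (j + 2 * m * k) * z.im := by
    have : (-(j + 2 * m * k : ℝ) ^ 2 * (τ : ℂ) / (4 * m) + (j + 2 * m * k : ℝ) * z) =
      ((-(j + 2 * m * k) ^ 2 / (4 * m) : ℝ) : ℂ) * τ + ((j + 2 * m * k : ℝ) : ℂ) * z := by
      push_cast; ring
    rw [this, Complex.add_im, Complex.im_ofReal_mul, Complex.im_ofReal_mul, UpperHalfPlane.coe_im]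
    ring
  rw [him, mul_assoc (-Real.pi), mul_comm (κ ^ 2), ← mul_assoc, hκ2]
  field_simp
  ring

lemma summable_norm_Theta {m : ℝ} (hm0 : 0 < m) (ε : ℤˣ) (j : ℝ) (τ : ℍ) (z : ℂ) :
    Summable fun n : ℤ => ‖sgnPow ε n *
      (e (m * z * (n + j / (2 * m))) * e (m * (n + j / (2 * m)) ^ 2 * τ))‖ := by
  have hy : 0 < τ.im := τ.im_pos
  have hp := Real.pi_pos
  refine (summable_gaussian_linear (a := 2 * Real.pi * m * τ.im) (by positivity)
    (-2 * Real.pi * m * z.im - 2 * Real.pi * j * τ.im)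
    (-Real.pi * z.im * j - Real.pi * τ.im * j ^ 2 / (2 * m))).congr fun n => ?_
  have h1 : ((m : ℂ) * z * (n + j / (2 * m))).im = m * (n + j / (2 * m)) * z.im := by
    have : (m : ℂ) * z * (n + j / (2 * m)) = ((m * (n + j / (2 * m)) : ℝ) : ℂ) * z := by
      push_cast; ring
    rw [this, Complex.im_ofReal_mul]
  have h2 : ((m : ℂ) * (n + j / (2 * m)) ^ 2 * τ).im = m * (n + j / (2 * m)) ^ 2 * τ.im := by
    have : (m : ℂ) * (n + j / (2 * m)) ^ 2 * τ = ((m * (n + j / (2 * m)) ^ 2 : ℝ) : ℂ) * τ := by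
      push_cast; ring
    rw [this, Complex.im_ofReal_mul, UpperHalfPlane.coe_im]
  rw [norm_mul, norm_mul, norm_sgnPow, one_mul, norm_e, norm_e, ← Real.exp_add, h1, h2]
  congr 1
  field_simp
  ring

/-- The terms of the double series of the modifier. -/
noncomputable def modifierTerm (ε : ℤˣ) (m s : ℝ) (τ : ℍ) (z₁ z₂ : ℂ) (l n : ℤ) : ℂ :=
  sgnPow ε n * (((intSign l - E (psi m (s + l) τ ((z₁ - z₂) / 2)) : ℝ) : ℂ) *
    e (m * n * (z₁ + z₂) + (s + l) * z₁ + (m * n ^ 2 + (s + l) * n) * τ))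

lemma intSign_mul_add {N : ℕ} (i : Fin N) (k : ℤ) : intSign (k * N + i) = intSign k := by
  have hi := i.2
  unfold intSign
  congr 1
  rw [eq_iff_iff]
  constructor
  · intro h
    by_contra hk
    nlinarith
  · intro h
    positivity

/-- The two quadratic exponents combine to `m(n + j/2m)² - m(k + j/2m)²`. Factoring this in terms of
`n - k` leaves an exponent linear in `j + 2mk`, that is in `s + l` with `l = kN + i`. -/
lemma R_mul_Theta_term {N : ℕ} (hN : 0 < N) {m : ℝ} (hm : m = N / 2) (ε : ℤˣ) (s : ℝ) (τ : ℍ)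
    (z₁ z₂ : ℂ) (i : Fin N) (k n : ℤ) :
    (sgnPow ε k * RTerm (s + (i : ℕ)) m (s + (i : ℕ) + 2 * m * k) τ ((z₁ - z₂) / 2)) *
      (sgnPow ε n * (e (m * (z₁ + z₂) * (n + (s + (i : ℕ) : ℝ) / (2 * m))) *
        e (m * (n + (s + (i : ℕ) : ℝ) / (2 * m)) ^ 2 * τ))) =
      modifierTerm ε m s τ z₁ z₂ (k * N + i) (n - k) := by
  have hm0 : (m : ℂ) ≠ 0 := by
    rw [hm]; push_cast; exact div_ne_zero (by exact_mod_cast hN.ne') two_ne_zero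
  have hl : s + ((k * N + i : ℤ) : ℝ) = s + (i : ℕ) + 2 * m * k := by
    rw [hm]; push_cast; ring
  have hl' : (s : ℂ) + ((k * N + i : ℤ) : ℂ) = ((s + (i : ℕ) + 2 * m * k : ℝ) : ℂ) := by
    rw [← hl]; push_cast; rfl
  have hsgn : sgnPow ε k * sgnPow ε n = sgnPow ε (n - k) := by
    have := sgnPow_add ε (n - k) k
    rw [sub_add_cancel] at this
    rw [this, mul_left_comm, sgnPow_mul_self, mul_one]
  rw [modifierTerm, RTerm_eq hN hm, ← hsgn, intSign_mul_add, hl, hl']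
  rw [mul_mul_mul_comm, mul_assoc _ (e _), ← e_add, ← e_add]
  congr 2
  congr 1
  push_cast
  field_simp
  ring

/-- Division with remainder by `N` in the first variable, with a shift of the second one. -/
noncomputable def divModShift (N : ℕ) [NeZero N] : Fin N × (ℤ × ℤ) ≃ ℤ × ℤ where
  toFun p := (p.2.1 * N + p.1, p.2.2 - p.2.1)
  invFun q := ((Int.divModEquiv N q.1).2, ((Int.divModEquiv N q.1).1,
    q.2 + (Int.divModEquiv N q.1).1))
  left_inv p := by
    have := (Int.divModEquiv N).apply_symm_apply (p.2.1, p.1)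
    simp only [Int.divModEquiv_symm_apply] at this
    simp [this]
  right_inv q := by
    have := (Int.divModEquiv N).symm_apply_apply q.1
    simp only [Int.divModEquiv_symm_apply] at this
    ext
    · simpa using this
    · simp

lemma hasSum_modifierTerm {N : ℕ} (hN : 0 < N) {m : ℝ} (hm : m = N / 2) (ε : ℤˣ) (s : ℝ) (τ : ℍ)
    (z₁ z₂ : ℂ) :
    HasSum (fun q : ℤ × ℤ => modifierTerm ε m s τ z₁ z₂ q.1 q.2) (PhiAdd ε m s τ z₁ z₂) := by
  have hm0 : 0 < m := by rw [hm]; positivity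
  have : NeZero N := ⟨hN.ne'⟩
  have hR (i : Fin N) := summable_norm_RTerm hN hm ε (s + (i : ℕ)) τ ((z₁ - z₂) / 2)
  have hT (i : Fin N) := summable_norm_Theta hm0 ε (s + (i : ℕ)) τ (z₁ + z₂)
  rw [← (divModShift N).hasSum_iff]
  have hF : ((fun q : ℤ × ℤ => modifierTerm ε m s τ z₁ z₂ q.1 q.2) ∘ divModShift N) =
      fun p : Fin N × (ℤ × ℤ) => (sgnPow ε p.2.1 *
        RTerm (s + (p.1 : ℕ)) m (s + (p.1 : ℕ) + 2 * m * p.2.1) τ ((z₁ - z₂) / 2)) *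
        (sgnPow ε p.2.2 * (e (m * (z₁ + z₂) * (p.2.2 + (s + (p.1 : ℕ) : ℝ) / (2 * m))) *
        e (m * (p.2.2 + (s + (p.1 : ℕ) : ℝ) / (2 * m)) ^ 2 * τ))) := by
    ext p
    rw [R_mul_Theta_term hN hm]
    rfl
  rw [hF]
  have hsum : Summable fun p : Fin N × (ℤ × ℤ) => (sgnPow ε p.2.1 *
        RTerm (s + (p.1 : ℕ)) m (s + (p.1 : ℕ) + 2 * m * p.2.1) τ ((z₁ - z₂) / 2)) *
        (sgnPow ε p.2.2 * (e (m * (z₁ + z₂) * (p.2.2 + (s + (p.1 : ℕ) : ℝ) / (2 * m))) *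
        e (m * (p.2.2 + (s + (p.1 : ℕ) : ℝ) / (2 * m)) ^ 2 * τ))) := by
    refine Summable.of_norm ((summable_prod_of_nonneg fun _ => norm_nonneg _).2
      ⟨fun i => ?_, (hasSum_fintype _).summable⟩)
    simpa only [norm_mul] using! (hR i).mul_norm (hT i)
  convert hsum.hasSum using 1
  rw [hsum.tsum_prod, tsum_fintype, PhiAdd, show ⌈2 * m⌉₊ = N by rw [hm]; simp [mul_div_cancel₀],
    Finset.sum_range]
  refine Finset.sum_congr rfl fun i _ => ?_
  rw [R, Theta]
  exact tsum_mul_tsum_of_summable_norm (hR i) (hT i)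

/-! ### The Kronecker–Eisenstein series -/

/-- The terms of the Kronecker–Eisenstein series:
`exp(-π m |W|² / y + 2πi m Im(W z̄₂) / y) / W` with `y = Im τ`. -/
noncomputable def kronecker (m : ℝ) (τ : ℍ) (z₂ W : ℂ) : ℂ :=
  Complex.exp (Real.pi * m / τ.im * (-(W * conj W) + W * conj z₂ - conj W * z₂)) / W

lemma norm_kronecker (m : ℝ) (τ : ℍ) (z₂ W : ℂ) :
    ‖kronecker m τ z₂ W‖ = Real.exp (-(Real.pi * m / τ.im) * ‖W‖ ^ 2) / ‖W‖ := by
  rw [kronecker, norm_div, Complex.norm_exp]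
  congr 2
  have h1 : (Real.pi * m / τ.im : ℂ) = ((Real.pi * m / τ.im : ℝ) : ℂ) := by push_cast; rfl
  rw [h1, Complex.re_ofReal_mul, Complex.mul_conj, Complex.normSq_eq_norm_sq]
  have h2 : (W * conj z₂ - conj W * z₂).re = 0 := by simp [Complex.mul_re]
  rw [add_sub_assoc, Complex.add_re, h2, Complex.neg_re, Complex.ofReal_re]
  ring

/-- One majorant for all `z` in a disc: the distinctness argument needs bounds that stay fixed as
`z₁` approaches a pole. -/
lemma summable_lattice_gaussian {a : ℝ} (ha : 0 < a) (τ : ℍ) (M : ℝ) :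
    ∃ g : ℤ × ℤ → ℝ, Summable g ∧ ∀ z : ℂ, ‖z‖ ≤ M → ∀ p : ℤ × ℤ,
      Real.exp (-a * ‖z + p.1 * τ + p.2‖ ^ 2) ≤ g p := by
  set r := EisensteinSeries.r τ with hr
  have hr0 : 0 < r := EisensteinSeries.r_pos τ
  have hs := summable_gaussian_linear (a := a * r ^ 2 / 4) (by positivity) 0 0
  refine ⟨fun p => Real.exp (a * M ^ 2) * (Real.exp (-(a * r ^ 2 / 4) * p.1 ^ 2 + 0 * p.1 + 0) *
    Real.exp (-(a * r ^ 2 / 4) * p.2 ^ 2 + 0 * p.2 + 0)),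
    (hs.mul_of_nonneg hs (fun _ => (Real.exp_pos _).le) (fun _ => (Real.exp_pos _).le)).mul_left _,
    fun z hz p => ?_⟩
  beta_reduce
  rw [← Real.exp_add, ← Real.exp_add, Real.exp_le_exp]
  have h1 : r ^ 2 * ((p.1 : ℝ) ^ 2 + p.2 ^ 2) ≤ 2 * ‖(p.1 : ℂ) * τ + p.2‖ ^ 2 := by
    by_cases hp : (![p.1, p.2] : Fin 2 → ℤ) = 0
    · have h10 : p.1 = 0 := congrFun hp 0
      have h20 : p.2 = 0 := congrFun hp 1
      simp [h10, h20]
    · have h := EisensteinSeries.r_mul_max_le τ hp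
      have e1 : |(p.1 : ℝ)| ≤ ‖(![p.1, p.2] : Fin 2 → ℤ)‖ := by
        simpa [Int.norm_eq_abs] using norm_le_pi_norm (![p.1, p.2] : Fin 2 → ℤ) 0
      have e2 : |(p.2 : ℝ)| ≤ ‖(![p.1, p.2] : Fin 2 → ℤ)‖ := by
        simpa [Int.norm_eq_abs] using norm_le_pi_norm (![p.1, p.2] : Fin 2 → ℤ) 1
      set X := ‖(![p.1, p.2] : Fin 2 → ℤ)‖
      simp only [Matrix.cons_val_zero, Matrix.cons_val_one] at h
      have f1 : (p.1 : ℝ) ^ 2 ≤ X ^ 2 := by rw [← sq_abs]; gcongr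
      have f2 : (p.2 : ℝ) ^ 2 ≤ X ^ 2 := by rw [← sq_abs]; gcongr
      have f3 : (r * X) ^ 2 ≤ ‖(p.1 : ℂ) * τ + p.2‖ ^ 2 := by gcongr
      nlinarith [mul_le_mul_of_nonneg_left f1 (sq_nonneg r),
        mul_le_mul_of_nonneg_left f2 (sq_nonneg r)]
  have h2 : ‖(p.1 : ℂ) * τ + p.2‖ ≤ ‖z + p.1 * τ + p.2‖ + M := by
    calc ‖(p.1 : ℂ) * τ + p.2‖ = ‖(z + p.1 * τ + p.2) - z‖ := by ring_nf
      _ ≤ ‖z + p.1 * τ + p.2‖ + ‖z‖ := norm_sub_le _ _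
      _ ≤ _ := by linarith
  have h3 : ‖(p.1 : ℂ) * τ + p.2‖ ^ 2 ≤ 2 * ‖z + p.1 * τ + p.2‖ ^ 2 + 2 * M ^ 2 := by
    have : ‖(p.1 : ℂ) * τ + p.2‖ ^ 2 ≤ (‖z + p.1 * τ + p.2‖ + M) ^ 2 := by gcongr
    nlinarith [sq_nonneg (‖z + p.1 * τ + p.2‖ - M)]
  have h4 := mul_le_mul_of_nonneg_left (h1.trans (mul_le_mul_of_nonneg_left h3 two_pos.le)) ha.le
  linarith

lemma summable_norm_kronecker {m : ℝ} (hm : 0 < m) (τ : ℍ) (z₁ z₂ : ℂ) :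
    Summable fun p : ℤ × ℤ => ‖kronecker m τ z₂ (z₁ + p.1 * τ + p.2)‖ := by
  have hy : 0 < τ.im := τ.im_pos
  have hp := Real.pi_pos
  have ha : 0 < Real.pi * m / τ.im := by positivity
  obtain ⟨g, hg, hle⟩ := summable_lattice_gaussian ha τ ‖z₁‖
  refine Summable.of_norm_bounded_eventually hg ?_
  -- Off a finite set the Gaussian is below its value at `‖W‖ = 1`, so `‖W‖ > 1` and the denominator
  -- does no harm.
  have hev := hg.tendsto_cofinite_zero.eventually_lt_const (Real.exp_pos (-(Real.pi * m / τ.im)))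
  filter_upwards [hev] with p hlt
  have h := hle z₁ le_rfl p
  rw [norm_norm, norm_kronecker]
  have h1 : 1 ≤ ‖z₁ + p.1 * τ + p.2‖ := by
    have h2 := Real.exp_lt_exp.1 (h.trans_lt hlt)
    have h3 : 1 < ‖z₁ + p.1 * τ + p.2‖ ^ 2 := by
      by_contra! hc
      nlinarith [mul_le_mul_of_nonneg_left hc ha.le]
    nlinarith [norm_nonneg (z₁ + p.1 * τ + p.2)]
  exact (div_le_self (Real.exp_pos _).le h1).trans h

/-! ### Quadratic characters of the period lattice -/

/-- The sign `(-1)ˣ` for `x` modulo `2`. -/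
def paritySign (x : ZMod 2) : ℤ := if x = 0 then 1 else -1

lemma paritySign_add (x y : ZMod 2) : paritySign (x + y) = paritySign x * paritySign y := by
  revert x y; decide

/-- The sign `(-1)^(α n + β k + μ n k)`. -/
def latticeSign (μ α β : ZMod 2) (p : ℤ × ℤ) : ℂ :=
  (paritySign (α * p.1 + β * p.2 + μ * p.1 * p.2) : ℂ)

lemma norm_latticeSign (μ α β : ZMod 2) (p : ℤ × ℤ) : ‖latticeSign μ α β p‖ = 1 := by
  unfold latticeSign paritySign
  split_ifs <;> simp

/-- The class modulo `2` of the exponent of a sign. -/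
def unitParity (ε : ℤˣ) : ZMod 2 := if ε = 1 then 0 else 1

lemma e_half_mul (n : ℤ) : e (n / 2) = (paritySign n : ℂ) := by
  rcases Int.even_or_odd' n with ⟨k, rfl | rfl⟩
  · have h : (((2 * k : ℤ) : ZMod 2)) = 0 := (ZMod.intCast_zmod_eq_zero_iff_dvd _ 2).2 ⟨k, rfl⟩
    rw [h, show (((2 * k : ℤ) : ℂ) / 2) = (k : ℂ) by push_cast; ring, e_intCast]
    simp [paritySign]
  · have h : (((2 * k + 1 : ℤ) : ZMod 2)) = 1 := by
      have h0 : (((2 * k : ℤ) : ZMod 2)) = 0 := (ZMod.intCast_zmod_eq_zero_iff_dvd _ 2).2 ⟨k, rfl⟩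
      rw [Int.cast_add, h0]; rfl
    rw [h, show (((2 * k + 1 : ℤ) : ℂ) / 2) = (k : ℂ) + 1 / 2 by push_cast; ring, e_add, e_intCast, e,
      show 2 * (Real.pi : ℂ) * Complex.I * (1 / 2) = Real.pi * Complex.I by ring, Complex.exp_pi_mul_I]
    simp [paritySign]

lemma sgnPow_eq (ε : ℤˣ) (n : ℤ) : sgnPow ε n = (paritySign (unitParity ε * n) : ℂ) := by
  rcases Int.units_eq_one_or ε with rfl | rfl
  · simp [sgnPow, unitParity, paritySign]
  · have h : unitParity (-1) = 1 := rfl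
    rw [h, one_mul, sgnPow]
    rcases Int.even_or_odd n with hn | hn
    · have : (n : ZMod 2) = 0 := (ZMod.intCast_zmod_eq_zero_iff_dvd _ 2).2 hn.two_dvd
      simp [hn.neg_one_zpow, this, paritySign]
    · have : (n : ZMod 2) = 1 := ZMod.intCast_eq_one_iff_odd.2 hn
      simp [hn.neg_one_zpow, this, paritySign]

/-! ### The completed function as a Kronecker–Eisenstein series -/

/-- The primed variables stand for complex conjugates. Treating them as independent reduces the
comparison of exponents to a rational identity. -/
lemma damped_exponent_identity {D : ℂ} {n k m s τ τ' z₁ z₁' z₂ z₂' : ℂ} (hD : τ - τ' = D)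
    (hD0 : D ≠ 0) :
    m * n * (z₁ + z₂) + m * n ^ 2 * τ + s * (z₁ + n * τ) +
        ((m * ((z₁ - z₁') - (z₂ - z₂')) / D - s) * (z₁ + n * τ - k)) +
        -(m / D) * (z₁ + n * τ - k) ^ 2 =
      s * k + m * n * k + -(m * (z₁ - z₁') * z₂ / D) +
        m / D * (-((z₁ + n * τ - k) * (z₁' + n * τ' - k)) + (z₁ + n * τ - k) * z₂' -
          (z₁' + n * τ' - k) * z₂) := by
  subst hD
  field_simp
  ring

/-- The factor `e(s w)` meets `e(-s (w - k))` from the damping, leaving only `e(s k)`: this is how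
`s` disappears up to a sign. -/
lemma poleTerm_eq_kronecker {m : ℝ} (hm : 0 < m) (s : ℝ) (τ : ℍ) (z₁ z₂ : ℂ) (n k : ℤ) :
    e (m * n * (z₁ + z₂) + m * n ^ 2 * τ + s * (z₁ + n * τ)) *
      poleTerm (Real.sqrt (τ.im / m)) (2 * m * (((z₁ - z₂) / 2).im / τ.im) - s) (z₁ + n * τ) k =
    e (s * k) * e (m * n * k) * e (-(m * z₁.im * z₂ / τ.im)) *
      kronecker m τ z₂ (z₁ + n * τ - k) := by
  have hy : (τ.im : ℂ) ≠ 0 := by exact_mod_cast τ.im_pos.ne'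
  have him (z : ℂ) : ((z.im : ℝ) : ℂ) = (z - conj z) / (2 * Complex.I) := by
    rw [Complex.sub_conj]
    field_simp
    push_cast
    ring
  have hτ : ((τ.im : ℝ) : ℂ) = ((τ : ℂ) - conj (τ : ℂ)) / (2 * Complex.I) := him τ
  have hD0 : (τ : ℂ) - conj (τ : ℂ) ≠ 0 := by
    intro h
    rw [hτ, h, zero_div] at hy
    exact hy rfl
  have hm' : (m : ℂ) ≠ 0 := by exact_mod_cast hm.ne'
  have hI := Complex.I_ne_zero
  have key := damped_exponent_identity (n := n) (k := k) (m := m) (s := s) (z₁ := z₁)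
    (z₁' := conj z₁) (z₂ := z₂) (z₂' := conj z₂) (τ := τ) (τ' := conj (τ : ℂ)) rfl hD0
  have hsq : ((Real.sqrt (τ.im / m) : ℝ) : ℂ) ^ 2 = τ.im / m := by
    rw [← Complex.ofReal_pow, Real.sq_sqrt (div_nonneg τ.im_pos.le hm.le)]
    push_cast
    rfl
  rw [poleTerm, kronecker, hsq]
  simp only [div_eq_mul_inv _ (z₁ + n * τ - k), ← mul_assoc]
  congr 1
  simp only [e]
  simp only [← Complex.exp_add]
  congr 1
  push_cast
  rw [him ((z₁ - z₂) / 2), him z₁, hτ]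
  simp only [map_div₀, map_sub, map_add, map_mul, map_intCast, map_ofNat]
  have h2 := congrArg (fun x => 2 * (Real.pi : ℂ) * Complex.I * x) key
  linear_combination (norm := skip) h2
  generalize (τ : ℂ) - conj (τ : ℂ) = D at *
  field_simp
  ring

lemma Phi_term_sub_modifier {m : ℝ} (hm : 0 < m) (ε : ℤˣ) (s : ℝ) (τ : ℍ) {z₁ : ℂ} (z₂ : ℂ)
    (hz : ∀ a b : ℤ, z₁ ≠ a + b * (τ : ℂ)) (n : ℤ) :
    sgnPow ε n * (e (m * n * (z₁ + z₂) + s * z₁) * e ((m * n ^ 2 + s * n) * τ)) /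
        (1 - e z₁ * e (n * τ)) - 1 / 2 * ∑' l, modifierTerm ε m s τ z₁ z₂ l n =
      -(1 / (2 * Real.pi * Complex.I)) * e (-(m * z₁.im * z₂ / τ.im)) *
        ∑' k : ℤ, sgnPow ε n * e (s * k) * e (m * n * k) *
          kronecker m τ z₂ (z₁ + n * τ - k) := by
  have hw : ∀ k : ℤ, z₁ + n * τ ≠ k := fun k h => hz k (-n) (by rw [← h]; push_cast; ring)
  have hκ : 0 < Real.sqrt (τ.im / m) := Real.sqrt_pos.2 (div_pos τ.im_pos hm)
  have key := cotangent_expansion hκ (2 * m * (((z₁ - z₂) / 2).im / τ.im) - s) hw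
  set A := e (m * n * (z₁ + z₂) + m * n ^ 2 * τ + s * (z₁ + n * τ)) with hA
  have h1 : ∑' l, modifierTerm ε m s τ z₁ z₂ l n = sgnPow ε n * A *
      ∑' l, errorTerm (Real.sqrt (τ.im / m)) (2 * m * (((z₁ - z₂) / 2).im / τ.im) - s)
        (z₁ + n * τ) l := by
    rw [← tsum_mul_left]
    refine tsum_congr fun l => ?_
    rw [modifierTerm, errorTerm, hA, mul_assoc (sgnPow ε n), mul_left_comm (e _), ← e_add, psi]
    congr 3
    · rw [mul_comm (Real.sqrt _)]
      congr 3
      ring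
    · ring
  have h2 : e (m * n * (z₁ + z₂) + s * z₁) * e ((m * n ^ 2 + s * n) * τ) = A := by
    rw [hA, ← e_add]
    congr 1
    ring
  have h3 : ∑' k : ℤ, sgnPow ε n * e (s * k) * e (m * n * k) *
      kronecker m τ z₂ (z₁ + n * τ - k) * e (-(m * z₁.im * z₂ / τ.im)) =
      sgnPow ε n * A * ∑' k, poleTerm (Real.sqrt (τ.im / m))
        (2 * m * (((z₁ - z₂) / 2).im / τ.im) - s) (z₁ + n * τ) k := by
    rw [← tsum_mul_left]
    refine tsum_congr fun k => ?_
    rw [mul_assoc (sgnPow ε n) A, hA, poleTerm_eq_kronecker hm]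
    ring
  have h4 := h3
  rw [tsum_mul_right] at h4
  rw [h1, h2, ← e_add]
  linear_combination sgnPow ε n * A * key + (1 / (2 * Real.pi * Complex.I)) * h4

/-- The completed function is a Kronecker–Eisenstein series. -/
theorem PhiTilde_eq_kronecker {N : ℕ} (hN : 0 < N) {m : ℝ} (hm : m = N / 2) (ε : ℤˣ) {s : ℝ}
    {S : ℤ} (hs : s = S / 2) (p : Domain) :
    PhiTilde ε m s p = -(1 / (2 * Real.pi * Complex.I)) *
      e (-(m * p.1.2.1.im * p.1.2.2 / p.1.1.im)) *
      ∑' q : ℤ × ℤ, latticeSign N (unitParity ε) S q *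
        kronecker m p.1.1 p.1.2.2 (p.1.2.1 + q.1 * p.1.1 + q.2) := by
  obtain ⟨⟨τ, z₁, z₂⟩, hz⟩ := p
  simp only at hz ⊢
  have hm0 : 0 < m := by rw [hm]; positivity
  -- The pole `w = k` belongs to the lattice vector `(n, -k)`; the change of sign is invisible
  -- modulo 2.
  have hsign (n k : ℤ) : sgnPow ε n * e (s * k) * e (m * n * k) =
      latticeSign N (unitParity ε) S (n, -k) := by
    have h1 : (s : ℂ) * k = ((S * k : ℤ) : ℂ) / 2 := by rw [hs]; push_cast; ring
    have h2 : (m : ℂ) * n * k = ((N * n * k : ℤ) : ℂ) / 2 := by rw [hm]; push_cast; ring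
    have h3 : (((-k : ℤ)) : ZMod 2) = k := by rw [Int.cast_neg, ZMod.neg_eq_self_mod_two]
    rw [h1, h2, e_half_mul, e_half_mul, sgnPow_eq, latticeSign]
    simp only [h3, paritySign_add]
    push_cast
    rfl
  have hK : Summable fun q : ℤ × ℤ => latticeSign N (unitParity ε) S q *
      kronecker m τ z₂ (z₁ + q.1 * τ + q.2) := by
    refine Summable.of_norm ((summable_norm_kronecker hm0 τ z₁ z₂).congr fun q => ?_)
    rw [norm_mul, norm_latticeSign, one_mul]
  have hK' := ((Equiv.prodCongr (Equiv.refl ℤ) (Equiv.neg ℤ)).hasSum_iff.2 hK.hasSum).mul_left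
    (-(1 / (2 * Real.pi * Complex.I)) * e (-(m * z₁.im * z₂ / τ.im)))
  have hKn := hK'.prod_fiberwise fun n => hK'.summable.prod_factor n |>.hasSum
  have hU := ((Equiv.prodComm ℤ ℤ).hasSum_iff.2 (hasSum_modifierTerm hN hm ε s τ z₁ z₂))
  have hUn := (hU.prod_fiberwise fun n => hU.summable.prod_factor n |>.hasSum).mul_left (1 / 2)
  have hsum := hKn.add hUn
  unfold PhiTilde Phi
  rw [sub_eq_iff_eq_add, ← hsum.tsum_eq]
  refine tsum_congr fun n => ?_
  rw [← sub_eq_iff_eq_add]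
  refine (Phi_term_sub_modifier hm0 ε s τ z₂ hz n).trans ?_
  simp only [Function.comp_apply, tsum_mul_left, hsign]
  congr 1
  refine tsum_congr fun k => ?_
  simp [sub_eq_add_neg]

/-! ### The modular group permutes the Kronecker–Eisenstein series -/

/-- The normalized Kronecker–Eisenstein series with the quadratic character `(μ, α, β)`. -/
noncomputable def kroneckerSeries (m : ℝ) (μ α β : ZMod 2) : Domain → ℂ := fun p =>
  -(1 / (2 * Real.pi * Complex.I)) * e (-(m * p.1.2.1.im * p.1.2.2 / p.1.1.im)) *
    ∑' q : ℤ × ℤ, latticeSign μ α β q *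
      kronecker m p.1.1 p.1.2.2 (p.1.2.1 + q.1 * p.1.1 + q.2)

/-- The action of `SL₂(ℤ)` on the period lattice, in the coordinates `(n, k) ↦ n τ + k`. -/
def latticeEquiv (γ : SL(2, ℤ)) : ℤ × ℤ ≃ ℤ × ℤ where
  toFun q := (γ 0 0 * q.1 + γ 1 0 * q.2, γ 0 1 * q.1 + γ 1 1 * q.2)
  invFun q := (γ 1 1 * q.1 - γ 1 0 * q.2, -γ 0 1 * q.1 + γ 0 0 * q.2)
  left_inv q := by
    have h : γ 0 0 * γ 1 1 - γ 0 1 * γ 1 0 = 1 := by rw [← Matrix.det_fin_two]; exact γ.2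
    ext
    · linear_combination q.1 * h
    · linear_combination q.2 * h
  right_inv q := by
    have h : γ 0 0 * γ 1 1 - γ 0 1 * γ 1 0 = 1 := by rw [← Matrix.det_fin_two]; exact γ.2
    ext
    · linear_combination q.1 * h
    · linear_combination q.2 * h

lemma det_mod_two (γ : SL(2, ℤ)) :
    (γ 0 0 : ZMod 2) * γ 1 1 - γ 0 1 * γ 1 0 = 1 := by
  have h : γ 0 0 * γ 1 1 - γ 0 1 * γ 1 0 = 1 := by rw [← Matrix.det_fin_two]; exact γ.2
  exact_mod_cast congrArg _ h

/-- Since `x = x²` modulo 2, the exponent is a binary quadratic form. The new `α`, `β` are its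
values at the preimages of the basis vectors, and `μ` is preserved because the determinant is 1. -/
lemma latticeSign_latticeEquiv (γ : SL(2, ℤ)) (μ α β : ZMod 2) (q : ℤ × ℤ) :
    latticeSign μ (α * γ 1 1 + β * γ 0 1 + μ * γ 0 1 * γ 1 1)
        (α * γ 1 0 + β * γ 0 0 + μ * γ 0 0 * γ 1 0) (latticeEquiv γ q) = latticeSign μ α β q := by
  have h' := det_mod_two γ
  rw [latticeSign, latticeSign]
  congr 2
  simp only [latticeEquiv, Equiv.coe_fn_mk]
  push_cast
  generalize (γ 0 0 : ZMod 2) = a at *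
  generalize (γ 0 1 : ZMod 2) = b at *
  generalize (γ 1 0 : ZMod 2) = c at *
  generalize (γ 1 1 : ZMod 2) = d at *
  generalize (q.1 : ZMod 2) = n
  generalize (q.2 : ZMod 2) = k
  have key : ∀ a b c d : ZMod 2, a * d - b * c = 1 → ∀ α β μ n k : ZMod 2,
      (α * d + β * b + μ * b * d) * (a * n + c * k) + (α * c + β * a + μ * a * c) * (b * n + d * k) +
        μ * (a * n + c * k) * (b * n + d * k) = α * n + β * k + μ * n * k := by
    decide
  exact key a b c d h' α β μ n k

lemma ofReal_im_eq (z : ℂ) : ((z.im : ℝ) : ℂ) = (z - conj z) / (2 * Complex.I) := by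
  rw [Complex.sub_conj]
  field_simp
  push_cast
  ring

lemma ofReal_im_smul (γ : SL(2, ℤ)) (τ : ℍ) :
    (((γ • τ).im : ℝ) : ℂ) =
      τ.im / (((γ 1 0 : ℂ) * τ + γ 1 1) * conj ((γ 1 0 : ℂ) * τ + γ 1 1)) := by
  rw [ModularGroup.im_smul_eq_div_normSq, Complex.mul_conj]
  push_cast
  simp [UpperHalfPlane.denom]

/-- `Im τ` scales by `|cτ + d|⁻²`, so the exponent is invariant and only `1 / W` contributes a
factor. -/
lemma kronecker_smul (m : ℝ) (γ : SL(2, ℤ)) (τ : ℍ) (z W : ℂ) :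
    kronecker m (γ • τ) (z / ((γ 1 0 : ℂ) * τ + γ 1 1)) (W / ((γ 1 0 : ℂ) * τ + γ 1 1)) =
      ((γ 1 0 : ℂ) * τ + γ 1 1) * kronecker m τ z W := by
  have hJ := denom_ne γ τ
  have hJ' : conj ((γ 1 0 : ℂ) * τ + γ 1 1) ≠ 0 := (map_ne_zero _).2 hJ
  have hy : ((τ.im : ℝ) : ℂ) ≠ 0 := by exact_mod_cast τ.im_pos.ne'
  rw [kronecker, kronecker, ofReal_im_smul]
  simp only [map_div₀]
  generalize (γ 1 0 : ℂ) * τ + γ 1 1 = J at *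
  have hexp : (Real.pi * m / (τ.im / (J * conj J)) *
      (-(W / J * (conj W / conj J)) + W / J * (conj z / conj J) - conj W / conj J * (z / J)) : ℂ) =
      Real.pi * m / τ.im * (-(W * conj W) + W * conj z - conj W * z) := by
    field_simp
  rw [hexp, div_div_eq_mul_div, mul_comm _ J, mul_div_assoc]

/-- With `J = cτ + d`, everything reduces to `J - J̄ = 2i c Im τ`. -/
lemma automorphy_exponent (m : ℝ) (γ : SL(2, ℤ)) (τ : ℍ) (z₁ z₂ : ℂ) :
    -(m * γ 1 0 * z₁ * z₂ / ((γ 1 0 : ℂ) * τ + γ 1 1)) +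
      -(m * (z₁ / ((γ 1 0 : ℂ) * τ + γ 1 1)).im * (z₂ / ((γ 1 0 : ℂ) * τ + γ 1 1)) /
        (γ • τ).im) = -(m * z₁.im * z₂ / τ.im) := by
  have hJ := denom_ne γ τ
  have hJ' : conj ((γ 1 0 : ℂ) * τ + γ 1 1) ≠ 0 := (map_ne_zero _).2 hJ
  have hy : ((τ.im : ℝ) : ℂ) ≠ 0 := by exact_mod_cast τ.im_pos.ne'
  have hdiff : ((γ 1 0 : ℂ) * τ + γ 1 1) - conj ((γ 1 0 : ℂ) * τ + γ 1 1) =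
      2 * Complex.I * γ 1 0 * τ.im := by
    have h := ofReal_im_eq (τ : ℂ)
    rw [UpperHalfPlane.coe_im] at h
    rw [h]
    have := Complex.I_ne_zero
    field_simp
    simp
    ring
  have hI := Complex.I_ne_zero
  rw [ofReal_im_smul, ofReal_im_eq (z₁ / _), ofReal_im_eq z₁]
  simp only [map_div₀]
  generalize (γ 1 0 : ℂ) * τ + γ 1 1 = J at *
  field_simp
  linear_combination (m * z₂ * z₁) * hdiff

/-- The factor `cτ + d` from each term cancels the weight, the prefactor absorbs the index
exponential, and the lattice sum is reindexed. -/
theorem slash_kroneckerSeries (m : ℝ) (γ : SL(2, ℤ)) (μ α β : ZMod 2) :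
    slash m γ (kroneckerSeries m μ α β) =
      kroneckerSeries m μ (α * γ 1 1 + β * γ 0 1 + μ * γ 0 1 * γ 1 1)
        (α * γ 1 0 + β * γ 0 0 + μ * γ 0 0 * γ 1 0) := by
  ext ⟨⟨τ, z₁, z₂⟩, hz⟩
  have hJ := denom_ne γ τ
  simp only [slash, kroneckerSeries, act]
  conv_rhs => rw [← (latticeEquiv γ).tsum_eq]
  simp only [latticeSign_latticeEquiv]
  have hW (q : ℤ × ℤ) : z₁ / ((γ 1 0 : ℂ) * τ + γ 1 1) + q.1 * ((γ • τ : ℍ) : ℂ) + q.2 =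
      (z₁ + (latticeEquiv γ q).1 * τ + (latticeEquiv γ q).2) / ((γ 1 0 : ℂ) * τ + γ 1 1) := by
    have hτ := UpperHalfPlane.coe_specialLinearGroup_apply γ τ
    simp only [algebraMap_int_eq, eq_intCast, Complex.ofReal_intCast] at hτ
    rw [hτ]
    simp only [latticeEquiv, Equiv.coe_fn_mk]
    push_cast
    field_simp
    ring
  simp only [hW, kronecker_smul, mul_left_comm _ ((γ 1 0 : ℂ) * τ + γ 1 1), tsum_mul_left]
  rw [← automorphy_exponent m γ τ z₁ z₂, e_add]
  field_simp

lemma slash_T_kroneckerSeries (m : ℝ) (μ α β : ZMod 2) :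
    slash m ModularGroup.T (kroneckerSeries m μ α β) = kroneckerSeries m μ (α + β + μ) β := by
  rw [slash_kroneckerSeries]
  simp [ModularGroup.coe_T]

lemma slash_S_kroneckerSeries (m : ℝ) (μ α β : ZMod 2) :
    slash m ModularGroup.S (kroneckerSeries m μ α β) = kroneckerSeries m μ β α := by
  rw [slash_kroneckerSeries]
  simp [ModularGroup.coe_S, ZMod.neg_eq_self_mod_two]

lemma slash_kroneckerSeries_zero (m : ℝ) (γ : SL(2, ℤ)) :
    slash m γ (kroneckerSeries m 0 0 0) = kroneckerSeries m 0 0 0 := by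
  rw [slash_kroneckerSeries]
  simp

/-- The form `n + k + nk` vanishes modulo 2 only at the origin, so every invertible substitution
fixes it. -/
lemma slash_kroneckerSeries_one (m : ℝ) (γ : SL(2, ℤ)) :
    slash m γ (kroneckerSeries m 1 1 1) = kroneckerSeries m 1 1 1 := by
  have key : ∀ a b c d : ZMod 2, a * d - b * c = 1 →
      1 * d + 1 * b + 1 * b * d = 1 ∧ 1 * c + 1 * a + 1 * a * c = 1 := by decide
  obtain ⟨h₁, h₂⟩ := key _ _ _ _ (det_mod_two γ)
  rw [slash_kroneckerSeries, h₁, h₂]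

/-! ### Distinctness -/

lemma paritySign_injective : Function.Injective paritySign := by decide

lemma latticeSign_eq_or (μ α β : ZMod 2) (p : ℤ × ℤ) :
    latticeSign μ α β p = 1 ∨ latticeSign μ α β p = -1 := by
  unfold latticeSign paritySign
  split_ifs <;> simp

lemma half_le_norm_of_ne {p p₀ : ℤ × ℤ} (hp : p ≠ p₀) {t : ℝ} (ht0 : 0 < t) (ht : t ≤ 1 / 2) :
    1 / 2 ≤ ‖-(p₀.1 * Complex.I + p₀.2) + (t : ℂ) + p.1 * Complex.I + p.2‖ := by
  set W : ℂ := -(p₀.1 * Complex.I + p₀.2) + (t : ℂ) + p.1 * Complex.I + p.2 with hW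
  have him : W.im = ((p.1 - p₀.1 : ℤ) : ℝ) := by simp [hW]; ring
  have hre : W.re = ((p.2 - p₀.2 : ℤ) : ℝ) + t := by simp [hW]; ring
  by_cases h1 : p.1 = p₀.1
  · have h2 : p.2 - p₀.2 ≠ 0 := fun h => hp (Prod.ext h1 (by omega))
    refine le_trans ?_ (Complex.abs_re_le_norm W)
    rw [hre]
    have h3 : (1 : ℝ) ≤ |((p.2 - p₀.2 : ℤ) : ℝ)| := by exact_mod_cast Int.one_le_abs h2
    have h4 := abs_sub_abs_le_abs_sub ((p.2 - p₀.2 : ℤ) : ℝ) (-t)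
    rw [sub_neg_eq_add, abs_neg, abs_of_pos ht0] at h4
    linarith
  · refine le_trans ?_ (Complex.abs_im_le_norm W)
    rw [him]
    have h3 : (1 : ℝ) ≤ |((p.1 - p₀.1 : ℤ) : ℝ)| := by
      exact_mod_cast Int.one_le_abs (sub_ne_zero.2 h1)
    linarith

/-- Take `τ = i`, `z₂ = 0` and let `z₁` tend to the pole indexed by `p₀`. If the signs there
differed, that term of the difference would blow up like `1 / t` while the others stay bounded. -/
lemma latticeSign_eq_of_kroneckerSeries_eq {m : ℝ} (hm : 0 < m) {μ α β α' β' : ZMod 2}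
    (h : kroneckerSeries m μ α β = kroneckerSeries m μ α' β') (p₀ : ℤ × ℤ) :
    latticeSign μ α β p₀ = latticeSign μ α' β' p₀ := by
  by_contra hne
  have hp := Real.pi_pos
  set χ : ℤ × ℤ → ℂ := fun p => latticeSign μ α β p - latticeSign μ α' β' p with hχ
  have hχ2 (p) : ‖χ p‖ ≤ 2 := by
    refine (norm_sub_le _ _).trans ?_
    rw [norm_latticeSign, norm_latticeSign]
    norm_num
  have hχ0 : ‖χ p₀‖ = 2 := by
    rcases latticeSign_eq_or μ α β p₀ with h1 | h1 <;>
    rcases latticeSign_eq_or μ α' β' p₀ with h2 | h2 <;>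
    simp only [h1, h2, not_true_eq_false] at hne <;> simp only [hχ, h1, h2] <;> norm_num
  have ha : 0 < Real.pi * m := by positivity
  obtain ⟨g, hg, hle⟩ := summable_lattice_gaussian ha UpperHalfPlane.I
    (‖(p₀.1 : ℂ) * Complex.I + p₀.2‖ + 1)
  have key : ∀ t : ℝ, 0 < t → t ≤ 1 / 2 →
      2 * (Real.exp (-(Real.pi * m)) / t) ≤ ∑' p, 4 * g p := by
    intro t ht0 ht
    set z : ℂ := -(p₀.1 * Complex.I + p₀.2) + (t : ℂ) with hz
    have hzn : ‖z‖ ≤ ‖(p₀.1 : ℂ) * Complex.I + p₀.2‖ + 1 := by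
      refine (norm_add_le _ _).trans ?_
      rw [norm_neg, Complex.norm_real, Real.norm_of_nonneg ht0.le]
      linarith
    have hdom : ∀ a b : ℤ, z ≠ a + b * (UpperHalfPlane.I : ℂ) := by
      intro a b hab
      have hre := congrArg Complex.re hab
      simp [hz] at hre
      have h1 : t = ((a + p₀.2 : ℤ) : ℝ) := by push_cast; linarith
      rw [h1] at ht0 ht
      have h2 : 0 < a + p₀.2 := by exact_mod_cast ht0
      have h3 : ((1 : ℤ) : ℝ) ≤ ((a + p₀.2 : ℤ) : ℝ) := by exact_mod_cast h2
      push_cast at h3 ht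
      linarith
    have hs := summable_norm_kronecker hm UpperHalfPlane.I z 0
    have hsum (α β : ZMod 2) : Summable fun p : ℤ × ℤ => latticeSign μ α β p *
        kronecker m UpperHalfPlane.I 0 (z + p.1 * (UpperHalfPlane.I : ℂ) + p.2) :=
      Summable.of_norm (hs.congr fun p => by rw [norm_mul, norm_latticeSign, one_mul])
    have heq := congrFun h ⟨(UpperHalfPlane.I, z, 0), hdom⟩
    simp only [kroneckerSeries] at heq
    have hpre : -(1 / (2 * Real.pi * Complex.I)) *
        e (-(m * z.im * 0 / UpperHalfPlane.I.im)) ≠ 0 :=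
      mul_ne_zero (neg_ne_zero.2 (one_div_ne_zero Complex.two_pi_I_ne_zero)) (e_ne_zero _)
    have heq2 := mul_left_cancel₀ hpre heq
    have hzero : ∑' p : ℤ × ℤ, χ p *
        kronecker m UpperHalfPlane.I 0 (z + p.1 * (UpperHalfPlane.I : ℂ) + p.2) = 0 := by
      simp only [hχ, sub_mul]
      rw [(hsum α β).tsum_sub (hsum α' β'), heq2, sub_self]
    have hsumχ : Summable fun p : ℤ × ℤ => χ p *
        kronecker m UpperHalfPlane.I 0 (z + p.1 * (UpperHalfPlane.I : ℂ) + p.2) := by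
      simpa only [hχ, sub_mul] using (hsum α β).sub (hsum α' β')
    rw [hsumχ.tsum_eq_add_tsum_ite p₀, add_eq_zero_iff_eq_neg] at hzero
    have hb : ‖∑' p : ℤ × ℤ, if p = p₀ then 0 else χ p *
        kronecker m UpperHalfPlane.I 0 (z + p.1 * (UpperHalfPlane.I : ℂ) + p.2)‖ ≤
        ∑' p, 4 * g p := by
      refine tsum_of_norm_bounded (hg.mul_left 4).hasSum fun p => ?_
      have h0 := hle z hzn p
      split_ifs with hpp
      · rw [norm_zero]
        linarith [Real.exp_pos (-(Real.pi * m) * ‖z + p.1 * (UpperHalfPlane.I : ℂ) + p.2‖ ^ 2)]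
      · have hW : 1 / 2 ≤ ‖z + p.1 * (UpperHalfPlane.I : ℂ) + p.2‖ :=
          half_le_norm_of_ne hpp ht0 ht
        rw [norm_mul, norm_kronecker, UpperHalfPlane.I_im, div_one]
        have h1 : Real.exp (-(Real.pi * m) * ‖z + p.1 * (UpperHalfPlane.I : ℂ) + p.2‖ ^ 2) /
            ‖z + p.1 * (UpperHalfPlane.I : ℂ) + p.2‖ ≤ 2 * g p := by
          rw [div_le_iff₀ (by linarith)]
          have hg0 : 0 ≤ g p := (Real.exp_pos _).le.trans h0
          nlinarith
        calc _ ≤ 2 * (2 * g p) := mul_le_mul (hχ2 p) h1 (by positivity) two_pos.le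
          _ = 4 * g p := by ring
    rw [← norm_neg, ← hzero, norm_mul, hχ0, norm_kronecker, UpperHalfPlane.I_im, div_one] at hb
    have hW0 : z + p₀.1 * (UpperHalfPlane.I : ℂ) + p₀.2 = (t : ℂ) := by
      rw [hz, UpperHalfPlane.coe_I]
      ring
    rw [hW0, Complex.norm_real, Real.norm_of_nonneg ht0.le] at hb
    refine le_trans ?_ hb
    refine mul_le_mul_of_nonneg_left (div_le_div_of_nonneg_right (Real.exp_le_exp.2 ?_) ht0.le)
      two_pos.le
    have ht2 : t ^ 2 ≤ 1 := by nlinarith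
    nlinarith [mul_le_mul_of_nonneg_left ht2 ha.le]
  set B := ∑' p, 4 * g p
  have hE := Real.exp_pos (-(Real.pi * m))
  have hB : 0 < B := lt_of_lt_of_le (by positivity) (key (1 / 2) (by norm_num) le_rfl)
  -- For this `t`, `key` gives `2 exp(-πm) ≤ tB ≤ exp(-πm)`, a contradiction.
  set t := min (1 / 2) (Real.exp (-(Real.pi * m)) / B) with ht
  have ht0 : 0 < t := lt_min (by norm_num) (by positivity)
  have h1 := key t ht0 (min_le_left _ _)
  have h2 : t ≤ Real.exp (-(Real.pi * m)) / B := min_le_right _ _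
  rw [le_div_iff₀ hB] at h2
  rw [← mul_div_assoc, div_le_iff₀ ht0] at h1
  linarith

theorem kroneckerSeries_injective {m : ℝ} (hm : 0 < m) (μ : ZMod 2) :
    Function.Injective fun x : ZMod 2 × ZMod 2 => kroneckerSeries m μ x.1 x.2 := by
  intro x y h
  have h1 := latticeSign_eq_of_kroneckerSeries_eq hm h (1, 0)
  have h2 := latticeSign_eq_of_kroneckerSeries_eq hm h (0, 1)
  simp only [latticeSign, Int.cast_one, Int.cast_zero, mul_one, mul_zero, add_zero, zero_add,
    Int.cast_inj] at h1 h2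
  exact Prod.ext (paritySign_injective h1) (paritySign_injective h2)

/-! ### The four functions -/

/-- The parities `(α, β)` of the four functions. -/
def fourParities : Fin 4 → ZMod 2 × ZMod 2 := ![(0, 0), (0, 1), (1, 0), (1, 1)]

lemma fourParities_bijective : Function.Bijective fourParities := by decide

/-- The action of a matrix modulo `2` on quadratic characters. -/
def transformParities (μ a b c d : ZMod 2) (x : ZMod 2 × ZMod 2) : ZMod 2 × ZMod 2 :=
  (x.1 * d + x.2 * b + μ * b * d, x.1 * c + x.2 * a + μ * a * c)

lemma transformParities_bijective {μ a b c d : ZMod 2} (h : a * d - b * c = 1) :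
    Function.Bijective (transformParities μ a b c d) := by
  revert μ a b c d; decide

lemma exists_perm_fourParities {γ : SL(2, ℤ)} {m : ℝ} {μ : ZMod 2} :
    ∃ σ : Equiv.Perm (Fin 4), ∀ i,
      slash m γ (kroneckerSeries m μ (fourParities i).1 (fourParities i).2) =
        kroneckerSeries m μ (fourParities (σ i)).1 (fourParities (σ i)).2 := by
  have h' := det_mod_two γ
  let E₄ := Equiv.ofBijective _ fourParities_bijective
  refine ⟨(E₄.trans (Equiv.ofBijective _ (transformParities_bijective (μ := μ) h'))).trans E₄.symm,
    fun i => ?_⟩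
  have hσ : fourParities (((E₄.trans (Equiv.ofBijective _
      (transformParities_bijective (μ := μ) h'))).trans E₄.symm) i) =
      transformParities μ (γ 0 0) (γ 0 1) (γ 1 0) (γ 1 1) (fourParities i) :=
    E₄.apply_symm_apply _
  rw [slash_kroneckerSeries, hσ]
  rfl

end MockTheta

theorem corollary1p4 (m : ℝ) (hm : ∃ k : ℕ, 0 < k ∧ m = k / 2) :
    -- independence of `s` modulo `ℤ`
    (∀ (ε : ℤˣ) (s s₁ : ℝ), (∃ k : ℤ, s = k / 2) → (∃ k : ℤ, s₁ = k / 2) → (∃ k : ℤ, s - s₁ = k) →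
      PhiTilde ε m s = PhiTilde ε m s₁) ∧
    (∀ s s' : ℝ, (∃ k : ℤ, s = k) → (∃ k : ℤ, s' = 1 / 2 + k) →
      -- the four functions are distinct and permuted by `SL₂(ℤ)`
      Function.Injective (fourFunctions m s s') ∧
      (∀ γ : SL(2, ℤ), ∃ σ : Equiv.Perm (Fin 4), ∀ i,
        slash m γ (fourFunctions m s s' i) = fourFunctions m s s' (σ i)) ∧
      -- the case of a positive integer `m`
      ((∃ k : ℕ, m = k) →
        (∀ γ : SL(2, ℤ), slash m γ (PhiTilde 1 m s) = PhiTilde 1 m s) ∧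
        slash m ModularGroup.T (PhiTilde (-1) m s) = PhiTilde (-1) m s ∧
        slash m ModularGroup.T (PhiTilde 1 m s') = PhiTilde (-1) m s' ∧
        slash m ModularGroup.T (PhiTilde (-1) m s') = PhiTilde 1 m s' ∧
        slash m ModularGroup.S (PhiTilde (-1) m s') = PhiTilde (-1) m s' ∧
        slash m ModularGroup.S (PhiTilde (-1) m s) = PhiTilde 1 m s' ∧
        slash m ModularGroup.S (PhiTilde 1 m s') = PhiTilde (-1) m s) ∧
      -- the case `m ∈ 1/2 + ℤ_{≥ 0}`
      ((∃ k : ℕ, m = 1 / 2 + k) →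
        (∀ γ : SL(2, ℤ), slash m γ (PhiTilde (-1) m s') = PhiTilde (-1) m s') ∧
        slash m ModularGroup.T (PhiTilde 1 m s') = PhiTilde 1 m s' ∧
        slash m ModularGroup.T (PhiTilde 1 m s) = PhiTilde (-1) m s ∧
        slash m ModularGroup.T (PhiTilde (-1) m s) = PhiTilde 1 m s ∧
        slash m ModularGroup.S (PhiTilde 1 m s) = PhiTilde 1 m s ∧
        slash m ModularGroup.S (PhiTilde (-1) m s) = PhiTilde 1 m s' ∧
        slash m ModularGroup.S (PhiTilde 1 m s') = PhiTilde (-1) m s)) := by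
  obtain ⟨N, hN, hmN⟩ := hm
  have hm0 : 0 < m := by rw [hmN]; positivity
  -- From here on only the classes of `2m`, `2s` and the sign modulo 2 matter.
  have hΦ (ε : ℤˣ) (s : ℝ) (S : ℤ) (hs : s = S / 2) :
      PhiTilde ε m s = kroneckerSeries m N (unitParity ε) S :=
    funext fun p => PhiTilde_eq_kronecker hN hmN ε hs p
  have h2 : (2 : ZMod 2) = 0 := rfl
  refine ⟨?_, ?_⟩
  · rintro ε s s₁ ⟨S, hS⟩ ⟨S₁, hS₁⟩ ⟨k, hk⟩
    have h : S = S₁ + 2 * k := by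
      have : (S : ℝ) = S₁ + 2 * k := by rw [← hk, hS, hS₁]; ring
      exact_mod_cast this
    rw [hΦ ε s S hS, hΦ ε s₁ S₁ hS₁, h]
    push_cast
    rw [h2, zero_mul, add_zero]
  rintro s s' ⟨k, hk⟩ ⟨k', hk'⟩
  have hs (ε : ℤˣ) : PhiTilde ε m s = kroneckerSeries m N (unitParity ε) 0 := by
    rw [hΦ ε s (2 * k) (by rw [hk]; push_cast; ring)]
    push_cast
    rw [h2, zero_mul]
  have hs' (ε : ℤˣ) : PhiTilde ε m s' = kroneckerSeries m N (unitParity ε) 1 := by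
    rw [hΦ ε s' (1 + 2 * k') (by rw [hk']; push_cast; ring)]
    push_cast
    rw [h2, zero_mul, add_zero]
  have hone : unitParity 1 = 0 := rfl
  have hneg : unitParity (-1) = 1 := rfl
  have hfour : fourFunctions m s s' =
      fun i => kroneckerSeries m N (fourParities i).1 (fourParities i).2 := by
    ext i : 1
    fin_cases i <;> simp [fourFunctions, fourParities, hs, hs', hone, hneg]
  refine ⟨?_, fun γ => ?_, ?_, ?_⟩
  · rw [hfour]
    exact (kroneckerSeries_injective hm0 N).comp fourParities_bijective.1
  · rw [hfour]
    exact exists_perm_fourParities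
  · rintro ⟨k, hk⟩
    have hN0 : (N : ZMod 2) = 0 := by
      have : N = 2 * k := by
        have : (N : ℝ) = 2 * k := by rw [← hk, hmN]; ring
        exact_mod_cast this
      rw [this]; push_cast; rw [h2, zero_mul]
    simp only [hs, hs', hone, hneg, hN0, slash_T_kroneckerSeries, slash_S_kroneckerSeries,
      slash_kroneckerSeries_zero, implies_true, true_and]
    simp only [show (1 : ZMod 2) + 1 = 0 from rfl, add_zero, zero_add, and_self]
  · rintro ⟨k, hk⟩
    have hN1 : (N : ZMod 2) = 1 := by
      have : N = 1 + 2 * k := by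
        have : (N : ℝ) = 1 + 2 * k := by linarith
        exact_mod_cast this
      rw [this]; push_cast; rw [h2, zero_mul, add_zero]
    simp only [hs, hs', hone, hneg, hN1, slash_T_kroneckerSeries, slash_S_kroneckerSeries,
      slash_kroneckerSeries_one, implies_true, true_and]
    simp only [show (1 : ZMod 2) + 1 = 0 from rfl, add_zero, zero_add, and_self]
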